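/- Let $A$ be a smooth and proper differential graded $\mathbb{C}$-algebra, and let $\mathcal{T}$ be a $\mathbb{C}$-linear triangulated category that is equivalent, as a $\mathbb{C}$-linear triangulated category, to the perfect derived category $\mathrm{perf}(A)$. Let $\Lambda$ be a finitely generated free abelian group, $v\colon K(\mathcal{T})\to\Lambda$ a surjective group homomorphism from the Grothendieck group of $\mathcal{T}$, and $\|\cdot\|$ a norm on $\Lambda\otimes_{\mathbb{Z}}\mathbb{R}$. Let $\sigma=(Z,\{\mathcal{P}(\phi)\}_{\phi\in\mathbb{R}})$ be a (Bridgeland) stability condition on $\mathcal{T}$ with respect to $(\Lambda,v)$: $Z\colon\Lambda\to\mathbb{C}$ is a group homomorphism and the $\mathcal{P}(\phi)$ are full additive subcategories of $\mathcal{T}$, closed under isomorphism, such that 1. for $0\neq E\in\mathcal{P}(\phi)$ we have $Z(v(E))=m(E)e^{i\pi\phi}$ with $m(E)>0$; 2. $\mathcal{P}(\phi+1)=\mathcal{P}(\phi)[1]$ for all $\phi$; 3. $\mathrm{Hom}(E_1,E_2)=0$ for $E_i\in\mathcal{P}(\phi_i)$ with $\phi_1>\phi_2$; 4. every $0\neq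 E\in\mathcal{T}$ has a Harder–Narasimhan filtration, i.e. there are exact triangles $E_{i-1}\to E_i\to A_i\to E_{i-1}[1]$ $(1\le i\le p)$ with $E_0=0$, $E_p=E$, $A_i\in\mathcal{P}(\phi_i)$ and $\phi_1>\dots>\phi_p$; 5. (support property) there is $C>0$ such that $\|v(E)\|<C\,|Z(v(E))|$ for all $\phi$ and all $0\neq E\in\mathcal{P}(\phi)$. Its global dimension is $$\mathrm{gldim}\,\sigma:=\sup\{\phi_2-\phi_1 \mid \mathrm{Hom}_{\mathcal{T}}(E_1,E_2)\neq 0 \text{ for some } E_i\in\mathcal{P}(\phi_i)\}\in[0,+\infty].$$ Suppose that $\mathrm{gldim}\,\sigma<1$ and that $\mathcal{T}$ is connected, i.e. $\mathcal{T}$ has no orthogonal decomposition into two nonzero full triangulated subcategories. Then $\mathcal{T}$ has a full strong exceptional collection: there are $n\ge 0$ and objects $E_1,\dots,E_n$ of $\mathcal{T}$ such that $\mathrm{Hom}(E_i,E_i)=\mathbb{C}$ for all $i$; $\mathrm{Hom}(E_j,E_i[k])=0$ for all $i<j$ and all $k\in\mathbb{Z}$; $\mathrm{Hom}(E_i,E_j[k])=0$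 for all $i,j$ and all $k\neq 0$; and the smallest full triangulated subcategory of $\mathcal{T}$, closed under isomorphism, that contains $E_1,\dots,E_n$ is $\mathcal{T}$ itself. (The case $n=0$ occurs only for $\mathcal{T}=0$.) -/

import Mathlib

open CategoryTheory CategoryTheory.Limits CategoryTheory.Pretriangulated
open scoped TensorProduct

noncomputable section

universe u

namespace DGStab

/-! ### Differential graded algebras over the complex numbers -/

/-- A dg algebra over `ℂ`: a `ℤ`-graded algebra `A = ⨁ Aⁱ` with a differential of degree `1`
satisfying the graded Leibniz rule. -/
structure DGAlgebra where
  carrier : Type u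
  [ring : Ring carrier]
  [algebra : Algebra ℂ carrier]
  gr : ℤ → Submodule ℂ carrier
  isInternal : DirectSum.IsInternal gr
  one_mem : (1 : carrier) ∈ gr 0
  mul_mem : ∀ {i j : ℤ} {a b : carrier}, a ∈ gr i → b ∈ gr j → a * b ∈ gr (i + j)
  d : carrier →ₗ[ℂ] carrier
  d_mem : ∀ {i : ℤ} {a : carrier}, a ∈ gr i → d a ∈ gr (i + 1)
  d_d : ∀ a : carrier, d (d a) = 0
  leibniz : ∀ {i : ℤ} {a : carrier} (b : carrier), a ∈ gr i →
    d (a * b) = d a * b + i.negOnePow • (a * d b)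

attribute [instance] DGAlgebra.ring DGAlgebra.algebra

/-- The total cohomology `⨁ᵢ Hⁱ(A) = ker d / im d`. -/
abbrev DGAlgebra.Cohomology (A : DGAlgebra.{u}) : Type u :=
  LinearMap.ker A.d ⧸ (LinearMap.range A.d).comap (LinearMap.ker A.d).subtype

/-- `A` is proper: its total cohomology is finite-dimensional. -/
def DGAlgebra.IsProper (A : DGAlgebra.{u}) : Prop :=
  FiniteDimensional ℂ A.Cohomology

/-! ### Dg modules -/

/-- A right dg module over `A`; `act a m` is `m · a`. -/
structure DGMod (A : DGAlgebra.{u}) where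
  carrier : Type u
  [addCommGroup : AddCommGroup carrier]
  [module : Module ℂ carrier]
  gr : ℤ → Submodule ℂ carrier
  isInternal : DirectSum.IsInternal gr
  act : A.carrier →ₗ[ℂ] carrier →ₗ[ℂ] carrier
  act_one : ∀ m, act 1 m = m
  act_mul : ∀ a b m, act (a * b) m = act b (act a m)
  act_mem : ∀ {i j : ℤ} {m a}, m ∈ gr i → a ∈ A.gr j → act a m ∈ gr (i + j)
  d : carrier →ₗ[ℂ] carrier
  d_mem : ∀ {i : ℤ} {m}, m ∈ gr i → d m ∈ gr (i + 1)
  d_d : ∀ m, d (d m) = 0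
  leibniz : ∀ {i : ℤ} {m} (a : A.carrier), m ∈ gr i →
    d (act a m) = act a (d m) + i.negOnePow • act (A.d a) m

attribute [instance] DGMod.addCommGroup DGMod.module

namespace DGMod

variable {A : DGAlgebra.{u}}

/-- The space `Homᵏ(M, N)` of `A`-linear maps of degree `k`, not necessarily compatible with
the differentials. -/
def homDeg (M N : DGMod A) (k : ℤ) : Submodule ℂ (M.carrier →ₗ[ℂ] N.carrier) where
  carrier := {f | (∀ i, ∀ m ∈ M.gr i, f m ∈ N.gr (i + k)) ∧
    ∀ a m, f (M.act a m) = N.act a (f m)}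
  add_mem' := fun hf hg =>
    ⟨fun i m hm => Submodule.add_mem _ (hf.1 i m hm) (hg.1 i m hm),
      fun a m => by simp [hf.2 a m, hg.2 a m]⟩
  zero_mem' := ⟨fun i m _ => Submodule.zero_mem _, fun a m => by simp⟩
  smul_mem' := fun c f hf =>
    ⟨fun i m hm => Submodule.smul_mem _ c (hf.1 i m hm), fun a m => by simp [hf.2 a m]⟩

/-- Morphisms of dg modules: closed `A`-linear maps of degree `0`. -/
def homs (M N : DGMod A) : Submodule ℂ (M.carrier →ₗ[ℂ] N.carrier) where
  carrier := {f | f ∈ homDeg M N 0 ∧ ∀ m, f (M.d m) = N.d (f m)}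
  add_mem' := fun hf hg =>
    ⟨Submodule.add_mem _ hf.1 hg.1, fun m => by simp [hf.2 m, hg.2 m]⟩
  zero_mem' := ⟨Submodule.zero_mem _, fun m => by simp⟩
  smul_mem' := fun c f hf => ⟨Submodule.smul_mem _ c hf.1, fun m => by simp [hf.2 m]⟩

instance : Category.{u} (DGMod A) where
  Hom M N := homs M N
  id M := ⟨LinearMap.id, ⟨fun i m hm => by simpa using hm, fun a m => rfl⟩, fun m => rfl⟩
  comp f g := ⟨g.1 ∘ₗ f.1,
    ⟨fun i m hm => by simpa using g.2.1.1 _ _ (f.2.1.1 i m hm),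
      fun a m => by simp [f.2.1.2, g.2.1.2]⟩, fun m => by simp [f.2.2, g.2.2]⟩

/-- The linear map underlying a morphism of dg modules. -/
def lin {M N : DGMod A} (f : M ⟶ N) : M.carrier →ₗ[ℂ] N.carrier := f.1

/-- A morphism of dg modules from its underlying linear map. -/
def ofLin {M N : DGMod A} (f : M.carrier →ₗ[ℂ] N.carrier) (hf : f ∈ homs M N) : M ⟶ N := ⟨f, hf⟩

@[simp] lemma lin_ofLin {M N : DGMod A} (f : M.carrier →ₗ[ℂ] N.carrier) (hf : f ∈ homs M N) :
    lin (ofLin f hf) = f := rfl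

lemma lin_mem {M N : DGMod A} (f : M ⟶ N) : lin f ∈ homs M N := f.2

@[ext] lemma hom_ext {M N : DGMod A} {f g : M ⟶ N} (h : lin f = lin g) : f = g :=
  Subtype.ext h

@[simp] lemma lin_id (M : DGMod A) : lin (𝟙 M) = LinearMap.id := rfl

@[simp] lemma lin_comp {M N P : DGMod A} (f : M ⟶ N) (g : N ⟶ P) :
    lin (f ≫ g) = lin g ∘ₗ lin f := rfl

instance : Preadditive (DGMod A) where
  homGroup M N := inferInstanceAs (AddCommGroup (homs M N))
  add_comp _ _ _ f f' g := Subtype.ext (LinearMap.comp_add f.1 f'.1 g.1)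
  comp_add _ _ _ f g g' := Subtype.ext (LinearMap.add_comp f.1 g'.1 g.1)

instance : Linear ℂ (DGMod A) where
  homModule M N := inferInstanceAs (Module ℂ (homs M N))
  smul_comp _ _ _ r f g := Subtype.ext (LinearMap.comp_smul g.1 r f.1)
  comp_smul _ _ _ f r g := Subtype.ext (LinearMap.smul_comp r g.1 f.1)

@[simp] lemma lin_add {M N : DGMod A} (f g : M ⟶ N) : lin (f + g) = lin f + lin g := rfl

@[simp] lemma lin_sub {M N : DGMod A} (f g : M ⟶ N) : lin (f - g) = lin f - lin g := rfl

@[simp] lemma lin_smul {M N : DGMod A} (r : ℂ) (f : M ⟶ N) : lin (r • f) = r • lin f := rfl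

/-- `A` as a right dg module over itself. -/
def self (A : DGAlgebra.{u}) : DGMod A where
  carrier := A.carrier
  gr := A.gr
  isInternal := A.isInternal
  act := (LinearMap.mul ℂ A.carrier).flip
  act_one m := by simp
  act_mul a b m := by simp [mul_assoc]
  act_mem hm ha := A.mul_mem hm ha
  d := A.d
  d_mem := A.d_mem
  d_d := A.d_d
  leibniz a hm := A.leibniz a hm

/-! #### The shift -/

lemma isInternal_shift {V : Type u} [AddCommGroup V] [Module ℂ V] {gr : ℤ → Submodule ℂ V}
    (h : DirectSum.IsInternal gr) (n : ℤ) : DirectSum.IsInternal fun i => gr (i + n) := by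
  rw [DirectSum.isInternal_submodule_iff_iSupIndep_and_iSup_eq_top] at h ⊢
  exact ⟨h.1.comp (add_left_injective n), by
    rw [← h.2]; exact (Equiv.addRight n).iSup_comp (g := gr)⟩

/-- The shift `M[n]`: `M[n]ⁱ = Mⁱ⁺ⁿ`, with differential `(-1)ⁿ d` and the same right action. -/
def shift (M : DGMod A) (n : ℤ) : DGMod A where
  carrier := M.carrier
  gr i := M.gr (i + n)
  isInternal := isInternal_shift M.isInternal n
  act := M.act
  act_one := M.act_one
  act_mul := M.act_mul
  act_mem {i j m a} hm ha := by
    have := M.act_mem hm ha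
    rwa [add_right_comm] at this
  d := n.negOnePow • M.d
  d_mem {i m} hm := by
    have := M.d_mem hm
    rw [add_right_comm] at this
    rw [LinearMap.smul_apply, Units.smul_def]
    exact zsmul_mem this _
  d_d m := by
    rw [LinearMap.smul_apply, LinearMap.smul_apply, Units.smul_def, Units.smul_def, map_zsmul,
      M.d_d, smul_zero, smul_zero]
  leibniz {i m} a hm := by
    simp only [LinearMap.smul_apply]
    rw [M.leibniz a hm, smul_add, smul_smul, Int.negOnePow_add, mul_comm i.negOnePow,
      ← mul_assoc, Int.units_mul_self, one_mul]
    simp only [Units.smul_def, map_zsmul]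

/-- The shift functor on dg modules; it does not change underlying maps. -/
def shiftFun (A : DGAlgebra.{u}) (n : ℤ) : DGMod A ⥤ DGMod A where
  obj M := M.shift n
  map {M N} f := ofLin (M := M.shift n) (N := N.shift n) (lin (M := M) (N := N) f)
    ⟨⟨fun i m hm => by
        have := (lin_mem f).1.1 _ m hm
        change lin f m ∈ N.gr (i + 0 + n)
        rwa [add_zero] at this ⊢,
      (lin_mem f).1.2⟩, fun (m : M.carrier) => by
        change lin f (n.negOnePow • M.d m) = n.negOnePow • N.d (lin f m)
        rw [Units.smul_def, Units.smul_def, map_zsmul, (lin_mem f).2]⟩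

/-- The isomorphism of dg modules given by a linear equivalence. -/
def isoOfLin {M N : DGMod A} (e : M.carrier ≃ₗ[ℂ] N.carrier) (h : e.toLinearMap ∈ homs M N)
    (h' : e.symm.toLinearMap ∈ homs N M) : M ≅ N where
  hom := ofLin _ h
  inv := ofLin _ h'
  hom_inv_id := by ext x; simp
  inv_hom_id := by ext x; simp

/-- `M[0] ≅ M`, by the identity map. -/
def shiftZeroIso (M : DGMod A) : M.shift 0 ≅ M :=
  isoOfLin (LinearEquiv.refl ℂ M.carrier)
    ⟨⟨fun i m hm => by
        change m ∈ M.gr (i + 0)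
        exact hm, fun a m => rfl⟩, fun m => by
        change (0 : ℤ).negOnePow • M.d m = M.d m
        rw [Int.negOnePow_zero, one_smul]⟩
    ⟨⟨fun i m hm => by
        change m ∈ M.gr (i + 0 + 0)
        rwa [add_zero, add_zero], fun a m => rfl⟩, fun m => by
        change M.d m = (0 : ℤ).negOnePow • M.d m
        rw [Int.negOnePow_zero, one_smul]⟩

/-- `M[a + b] ≅ M[a][b]`, by the identity map. -/
def shiftAddIso (M : DGMod A) (a b : ℤ) : M.shift (a + b) ≅ (M.shift a).shift b :=
  isoOfLin (LinearEquiv.refl ℂ M.carrier)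
    ⟨⟨fun i m hm => by
        change m ∈ M.gr (i + 0 + b + a)
        have : m ∈ M.gr (i + (a + b)) := hm
        rwa [add_zero, add_assoc, add_comm b a], fun a m => rfl⟩, fun m => by
        change (a + b).negOnePow • M.d m = b.negOnePow • a.negOnePow • M.d m
        rw [smul_smul, Int.negOnePow_add, mul_comm]⟩
    ⟨⟨fun i m hm => by
        change m ∈ M.gr (i + 0 + (a + b))
        have : m ∈ M.gr (i + b + a) := hm
        rwa [add_zero, add_comm a b, ← add_assoc], fun a m => rfl⟩, fun m => by
        change b.negOnePow • a.negOnePow • M.d m = (a + b).negOnePow • M.d m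
        rw [smul_smul, Int.negOnePow_add, mul_comm]⟩

lemma lin_eqToHom_shift (M : DGMod A) {a b : ℤ} (h : a = b) (h' : M.shift a = M.shift b)
    (x : M.carrier) :
    (lin (M := M.shift a) (N := M.shift b) (eqToHom h') : M.carrier →ₗ[ℂ] M.carrier) x = x := by
  subst h; rfl

instance : HasShift (DGMod A) ℤ := hasShiftMk _ _
  { F := shiftFun A
    zero := NatIso.ofComponents (fun M => shiftZeroIso M) (fun f => rfl)
    add := fun a b => NatIso.ofComponents (fun M => shiftAddIso M a b) (fun f => rfl)
    assoc_hom_app := fun a b c M => by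
      apply hom_ext
      refine LinearMap.ext fun x => ?_
      exact (lin_eqToHom_shift M (add_assoc a b c) _ x).symm
    zero_add_hom_app := fun n M => by
      apply hom_ext
      refine LinearMap.ext fun x => ?_
      exact (lin_eqToHom_shift M (zero_add n) _ x).symm
    add_zero_hom_app := fun n M => by
      apply hom_ext
      refine LinearMap.ext fun x => ?_
      exact (lin_eqToHom_shift M (add_zero n) _ x).symm }

/-! #### Mapping cones -/

lemma isInternal_prod {V W : Type u} [AddCommGroup V] [Module ℂ V] [AddCommGroup W] [Module ℂ W]
    {gr : ℤ → Submodule ℂ V} {gr' : ℤ → Submodule ℂ W}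
    (h : DirectSum.IsInternal gr) (h' : DirectSum.IsInternal gr') :
    DirectSum.IsInternal fun i => (gr i).prod (gr' i) := by
  rw [DirectSum.isInternal_submodule_iff_iSupIndep_and_iSup_eq_top] at h h' ⊢
  refine ⟨fun i => ?_, ?_⟩
  · have key : ⨆ (j) (_ : j ≠ i), (gr j).prod (gr' j) ≤
        (⨆ (j) (_ : j ≠ i), gr j).prod (⨆ (j) (_ : j ≠ i), gr' j) :=
      iSup₂_le fun j hj => Submodule.prod_mono (le_iSup₂ (f := fun j (_ : j ≠ i) => gr j) j hj)
        (le_iSup₂ (f := fun j (_ : j ≠ i) => gr' j) j hj)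
    refine Disjoint.mono_right key ?_
    rw [Submodule.disjoint_def]
    rintro ⟨x, y⟩ hx hy
    exact Prod.ext (Submodule.disjoint_def.1 (h.1 i) x hx.1 hy.1)
      (Submodule.disjoint_def.1 (h'.1 i) y hx.2 hy.2)
  · rw [eq_top_iff]
    rintro ⟨x, y⟩ -
    have hx : LinearMap.inl ℂ V W x ∈ ⨆ i, (gr i).prod (gr' i) := by
      have : LinearMap.inl ℂ V W x ∈ (⨆ i, gr i).map (LinearMap.inl ℂ V W) :=
        Submodule.mem_map_of_mem (h.2 ▸ Submodule.mem_top)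
      rw [Submodule.map_iSup] at this
      refine (iSup_mono fun i => ?_ : _ ≤ ⨆ i, (gr i).prod (gr' i)) this
      rintro _ ⟨v, hv, rfl⟩
      exact ⟨hv, Submodule.zero_mem _⟩
    have hy : LinearMap.inr ℂ V W y ∈ ⨆ i, (gr i).prod (gr' i) := by
      have : LinearMap.inr ℂ V W y ∈ (⨆ i, gr' i).map (LinearMap.inr ℂ V W) :=
        Submodule.mem_map_of_mem (h'.2 ▸ Submodule.mem_top)
      rw [Submodule.map_iSup] at this
      refine (iSup_mono fun i => ?_ : _ ≤ ⨆ i, (gr i).prod (gr' i)) this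
      rintro _ ⟨v, hv, rfl⟩
      exact ⟨Submodule.zero_mem _, hv⟩
    simpa using Submodule.add_mem _ hx hy

/-- The mapping cone of `f : M ⟶ N`: the graded module `M[1] ⊕ N` with differential
`(m, n) ↦ (-d m, f m + d n)`. -/
def cone {M N : DGMod A} (f : M ⟶ N) : DGMod A where
  carrier := M.carrier × N.carrier
  gr i := (M.gr (i + 1)).prod (N.gr i)
  isInternal := isInternal_prod (isInternal_shift M.isInternal 1) N.isInternal
  act := LinearMap.mk₂ ℂ (fun a x => (M.act a x.1, N.act a x.2))
    (fun a b x => by simp) (fun c a x => by simp) (fun a x y => by simp) (fun c a x => by simp)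
  act_one x := by simp [M.act_one, N.act_one]
  act_mul a b x := by simp [M.act_mul, N.act_mul]
  act_mem {i j x a} hx ha := by
    have h1 := M.act_mem hx.1 ha
    rw [add_right_comm] at h1
    exact ⟨h1, N.act_mem hx.2 ha⟩
  d := LinearMap.prod (-(M.d ∘ₗ LinearMap.fst ℂ _ _))
    (lin f ∘ₗ LinearMap.fst ℂ _ _ + N.d ∘ₗ LinearMap.snd ℂ _ _)
  d_mem {i x} hx := by
    have h1 := (lin_mem f).1.1 _ _ hx.1
    rw [add_zero] at h1
    exact ⟨Submodule.neg_mem _ (M.d_mem hx.1), Submodule.add_mem _ h1 (N.d_mem hx.2)⟩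
  d_d x := by
    have h := (lin_mem f).2 x.1
    simp [M.d_d, N.d_d, h]
  leibniz {i x} a hx := by
    have h1 := M.leibniz a hx.1
    have h2 := N.leibniz a hx.2
    have h3 := (lin_mem f).1.2 a x.1
    refine Prod.ext ?_ ?_
    · simp [h1, Int.negOnePow_succ, Units.smul_def, add_comm]
    · simp [h2, h3, add_assoc]

/-- The inclusion `N ⟶ cone f`. -/
def coneInr {M N : DGMod A} (f : M ⟶ N) : N ⟶ cone f :=
  ofLin (N := cone f) (LinearMap.inr ℂ M.carrier N.carrier)
    ⟨⟨fun i m hm => by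
        change (0 : M.carrier) ∈ M.gr (i + 0 + 1) ∧ m ∈ N.gr (i + 0)
        rw [add_zero]
        exact ⟨Submodule.zero_mem _, hm⟩, fun a m => by
        change ((0 : M.carrier), N.act a m) = (M.act a 0, N.act a m)
        rw [map_zero]⟩,
      fun m => by
        change ((0 : M.carrier), N.d m) = (-M.d 0, lin f 0 + N.d m)
        rw [map_zero, map_zero, neg_zero, zero_add]⟩

/-- The projection `cone f ⟶ M[1]`. -/
def coneFst {M N : DGMod A} (f : M ⟶ N) : cone f ⟶ (shiftFunctor (DGMod A) (1 : ℤ)).obj M :=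
  ofLin (M := cone f) (N := M.shift 1) (LinearMap.fst ℂ M.carrier N.carrier)
    ⟨⟨fun i x hx => by
        change x.1 ∈ M.gr (i + 0 + 1)
        rw [add_zero]
        exact hx.1, fun a x => rfl⟩,
      fun x => by
        change -M.d x.1 = (1 : ℤ).negOnePow • M.d x.1
        rw [Int.negOnePow_one, Units.neg_smul, one_smul]⟩

/-- The standard triangle `M ⟶ N ⟶ cone f ⟶ M[1]`. -/
def coneTriangle {M N : DGMod A} (f : M ⟶ N) : Triangle (DGMod A) :=
  Triangle.mk f (coneInr f) (coneFst f)

/-! #### The homotopy category -/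

/-- `f` and `g` are homotopic: `f - g = d h + h d` for some `A`-linear `h` of degree `-1`. -/
def homotopic (A : DGAlgebra.{u}) : HomRel (DGMod A) := fun M N f g =>
  ∃ h ∈ homDeg M N (-1), ∀ m, lin f m - lin g m = N.d (h m) + h (M.d m)

instance : Congruence (homotopic A) where
  equivalence :=
    { refl := fun f => ⟨0, Submodule.zero_mem _, fun m => by simp⟩
      symm := fun ⟨h, hh, e⟩ => ⟨-h, Submodule.neg_mem _ hh, fun m => by
        rw [← neg_sub, e]; simp [add_comm]⟩
      trans := fun ⟨h, hh, e⟩ ⟨h', hh', e'⟩ => ⟨h + h', Submodule.add_mem _ hh hh', fun m => by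
        rw [← sub_add_sub_cancel, e, e']; simp; abel⟩ }
  comp_left := by
    rintro M N P f g g' ⟨h, hh, e⟩
    refine ⟨h ∘ₗ lin f, ⟨fun i m hm => ?_, fun a m => ?_⟩, fun m => ?_⟩
    · have := (lin_mem f).1.1 i m hm
      rw [add_zero] at this
      exact hh.1 i _ this
    · simp [(lin_mem f).1.2, hh.2]
    · simp [e, (lin_mem f).2]
  comp_right := by
    rintro M N P f f' g ⟨h, hh, e⟩
    refine ⟨lin g ∘ₗ h, ⟨fun i m hm => ?_, fun a m => ?_⟩, fun m => ?_⟩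
    · have := (lin_mem g).1.1 _ _ (hh.1 i m hm)
      rwa [add_zero] at this
    · simp [(lin_mem g).1.2, hh.2]
    · simp [← map_sub, e, (lin_mem g).2]

instance : (homotopic A).IsCompatibleWithShift ℤ where
  condition := by
    rintro n M N f g ⟨h, hh, e⟩
    have h1 : ∀ (i : ℤ), ∀ m ∈ M.gr (i + n), n.negOnePow • h m ∈ N.gr (i + -1 + n) := by
      intro i m hm
      have := hh.1 _ m hm
      rw [add_right_comm] at this
      rw [Units.smul_def]
      exact zsmul_mem this _
    have h2 : ∀ a m, n.negOnePow • h (M.act a m) = N.act a (n.negOnePow • h m) := by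
      intro a m
      rw [hh.2, Units.smul_def, Units.smul_def, map_zsmul]
    have h3 : ∀ m, lin f m - lin g m = n.negOnePow • N.d (n.negOnePow • h m) +
        n.negOnePow • h (n.negOnePow • M.d m) := by
      intro m
      rw [e]
      simp only [Units.smul_def, map_zsmul]
      rw [smul_smul, smul_smul, ← Units.val_mul, Int.units_mul_self, Units.val_one, one_smul,
        one_smul]
    exact ⟨(n.negOnePow • h : M.carrier →ₗ[ℂ] N.carrier), ⟨h1, h2⟩, h3⟩

end DGMod

/-- The homotopy category of right dg modules over `A`. -/
abbrev HoDGMod (A : DGAlgebra.{u}) := CategoryTheory.Quotient (DGMod.homotopic A)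

namespace HoDGMod

variable (A : DGAlgebra.{u})

lemma homotopic_add ⦃X Y : DGMod A⦄ (f₁ f₂ g₁ g₂ : X ⟶ Y)
    (hf : DGMod.homotopic A f₁ f₂) (hg : DGMod.homotopic A g₁ g₂) :
    DGMod.homotopic A (f₁ + g₁) (f₂ + g₂) := by
  obtain ⟨h, hh, e⟩ := hf
  obtain ⟨h', hh', e'⟩ := hg
  refine ⟨h + h', Submodule.add_mem _ hh hh', fun m => ?_⟩
  rw [DGMod.lin_add, DGMod.lin_add, LinearMap.add_apply, LinearMap.add_apply, add_sub_add_comm,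
    e, e']
  simp; abel

instance : Preadditive (HoDGMod A) := Quotient.preadditive _ (homotopic_add A)

instance : (Quotient.functor (DGMod.homotopic A)).Additive where

instance : Linear ℂ (HoDGMod A) := Quotient.linear ℂ _ (by
  rintro r X Y f g ⟨h, hh, e⟩
  refine ⟨r • h, Submodule.smul_mem _ r hh, fun m => ?_⟩
  simp [← smul_sub, e])

/-- The distinguished triangles: those isomorphic to the triangle of a mapping cone. -/
def distinguished : Set (Triangle (HoDGMod A)) := {Δ | ∃ (M N : DGMod A) (f : M ⟶ N),
  Nonempty (Δ ≅ (Quotient.functor (DGMod.homotopic A)).mapTriangle.obj (DGMod.coneTriangle f))}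

end HoDGMod

/-! ### Perfect dg modules, smoothness -/

/-- A finitely generated semi-free dg module: as a graded module it is free on finitely many
homogeneous elements `e 0, …, e (n - 1)`, and `d (e j)` lies in the `A`-span of the preceding
ones. -/
def DGMod.IsSemifree {A : DGAlgebra.{u}} (P : DGMod A) : Prop :=
  ∃ (n : ℕ) (e : Fin n → P.carrier) (deg : Fin n → ℤ),
    (∀ j, e j ∈ P.gr (deg j)) ∧
    Function.Bijective (fun a : Fin n → A.carrier => ∑ j, P.act (a j) (e j)) ∧
    ∀ j, P.d (e j) ∈ Submodule.span ℂ {x | ∃ i < j, ∃ a, x = P.act a (e i)}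

/-- A perfect object: a direct summand, in the homotopy category, of a finitely generated
semi-free dg module. As these are homotopically projective, they form a full subcategory of the
derived category `D(A)` as well, namely `perf(A)`, the thick subcategory generated by `A`. -/
def HoDGMod.IsPerfect {A : DGAlgebra.{u}} (M : HoDGMod A) : Prop :=
  ∃ P : DGMod A, P.IsSemifree ∧
    Nonempty (Retract M ((Quotient.functor (DGMod.homotopic A)).obj P))

/-- A dg bimodule over `A`, that is, a dg module over the enveloping dg algebra `Aᵒᵖ ⊗ A`;
`lact a m` is `a · m` and `ract a m` is `m · a`. -/
structure DGBimod (A : DGAlgebra.{u}) where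
  carrier : Type u
  [addCommGroup : AddCommGroup carrier]
  [module : Module ℂ carrier]
  gr : ℤ → Submodule ℂ carrier
  isInternal : DirectSum.IsInternal gr
  lact : A.carrier →ₗ[ℂ] carrier →ₗ[ℂ] carrier
  lact_one : ∀ m, lact 1 m = m
  lact_mul : ∀ a b m, lact (a * b) m = lact a (lact b m)
  lact_mem : ∀ {i j : ℤ} {m a}, m ∈ gr i → a ∈ A.gr j → lact a m ∈ gr (j + i)
  ract : A.carrier →ₗ[ℂ] carrier →ₗ[ℂ] carrier
  ract_one : ∀ m, ract 1 m = m
  ract_mul : ∀ a b m, ract (a * b) m = ract b (ract a m)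
  ract_mem : ∀ {i j : ℤ} {m a}, m ∈ gr i → a ∈ A.gr j → ract a m ∈ gr (i + j)
  lact_ract : ∀ a b m, lact a (ract b m) = ract b (lact a m)
  d : carrier →ₗ[ℂ] carrier
  d_mem : ∀ {i : ℤ} {m}, m ∈ gr i → d m ∈ gr (i + 1)
  d_d : ∀ m, d (d m) = 0
  leibniz_left : ∀ {i : ℤ} {a : A.carrier} (m), a ∈ A.gr i →
    d (lact a m) = lact (A.d a) m + i.negOnePow • lact a (d m)
  leibniz_right : ∀ {i : ℤ} {m} (a : A.carrier), m ∈ gr i →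
    d (ract a m) = ract a (d m) + i.negOnePow • ract (A.d a) m

attribute [instance] DGBimod.addCommGroup DGBimod.module

namespace DGBimod

variable {A : DGAlgebra.{u}}

/-- `A` as a dg bimodule over itself, the diagonal bimodule. -/
def diagonal (A : DGAlgebra.{u}) : DGBimod A where
  carrier := A.carrier
  gr := A.gr
  isInternal := A.isInternal
  lact := LinearMap.mul ℂ A.carrier
  lact_one m := by simp
  lact_mul a b m := by simp [mul_assoc]
  lact_mem hm ha := A.mul_mem ha hm
  ract := (LinearMap.mul ℂ A.carrier).flip
  ract_one m := by simp
  ract_mul a b m := by simp [mul_assoc]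
  ract_mem hm ha := A.mul_mem hm ha
  lact_ract a b m := by simp [mul_assoc]
  d := A.d
  d_mem := A.d_mem
  d_d := A.d_d
  leibniz_left m ha := A.leibniz m ha
  leibniz_right a hm := A.leibniz a hm

/-- Maps of bimodules of degree `k`, with the Koszul sign `f (a m) = (-1)ᵏⁱ a (f m)` for `a` of
degree `i`; not necessarily compatible with the differentials. -/
def IsHomDeg (M N : DGBimod A) (k : ℤ) (f : M.carrier →ₗ[ℂ] N.carrier) : Prop :=
  (∀ i, ∀ m ∈ M.gr i, f m ∈ N.gr (i + k)) ∧
  (∀ i, ∀ a ∈ A.gr i, ∀ m, f (M.lact a m) = (k * i).negOnePow • N.lact a (f m)) ∧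
  ∀ a m, f (M.ract a m) = N.ract a (f m)

/-- Morphisms of dg bimodules: closed maps of degree `0`. -/
def IsHom (M N : DGBimod A) (f : M.carrier →ₗ[ℂ] N.carrier) : Prop :=
  IsHomDeg M N 0 f ∧ ∀ m, f (M.d m) = N.d (f m)

/-- A morphism is a quasi-isomorphism if it induces a bijection on cohomology. -/
def IsQuasiIso (M N : DGBimod A) (f : M.carrier →ₗ[ℂ] N.carrier) : Prop :=
  IsHom M N f ∧
  (∀ m, M.d m = 0 → (∃ y, f m = N.d y) → ∃ x, m = M.d x) ∧
  ∀ n, N.d n = 0 → ∃ m, M.d m = 0 ∧ ∃ y, f m - n = N.d y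

/-- The map of bimodules `A ⊗ A → P`, `a ⊗ b ↦ a e b`. -/
def tensorMap (P : DGBimod A) (e : P.carrier) : A.carrier ⊗[ℂ] A.carrier →ₗ[ℂ] P.carrier :=
  TensorProduct.lift (P.ract.flip ∘ₗ P.lact.flip e)

/-- A finitely generated semi-free dg bimodule: as a graded bimodule it is free on finitely many
homogeneous elements `e 0, …, e (n - 1)` (a finite direct sum of shifts of `A ⊗ A`), and `d (e j)`
lies in the sub-bimodule generated by the preceding ones. -/
def IsSemifree (P : DGBimod A) : Prop :=
  ∃ (n : ℕ) (e : Fin n → P.carrier) (deg : Fin n → ℤ),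
    (∀ j, e j ∈ P.gr (deg j)) ∧
    Function.Bijective (fun t : Fin n → A.carrier ⊗[ℂ] A.carrier => ∑ j, P.tensorMap (e j) (t j)) ∧
    ∀ j, P.d (e j) ∈ Submodule.span ℂ {x | ∃ i < j, ∃ a b, x = P.ract b (P.lact a (e i))}

/-- `Q` is a direct summand of `P` in the homotopy category of dg bimodules. -/
def IsHomotopySummand (Q P : DGBimod A) : Prop :=
  ∃ (i : Q.carrier →ₗ[ℂ] P.carrier) (p : P.carrier →ₗ[ℂ] Q.carrier)
    (h : Q.carrier →ₗ[ℂ] Q.carrier),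
    IsHom Q P i ∧ IsHom P Q p ∧ IsHomDeg Q Q (-1) h ∧
    ∀ x, p (i x) - x = Q.d (h x) + h (Q.d x)

end DGBimod

/-- `A` is smooth: the diagonal bimodule is perfect, i.e. quasi-isomorphic to a homotopy direct
summand of a finitely generated semi-free dg bimodule. -/
def DGAlgebra.IsSmooth (A : DGAlgebra.{u}) : Prop :=
  ∃ P Q : DGBimod A, P.IsSemifree ∧ Q.IsHomotopySummand P ∧
    ∃ f, DGBimod.IsQuasiIso Q (DGBimod.diagonal A) f

/-! ### Triangulated categories -/

section Triangulated

variable (T : Type*) [Category T] [Preadditive T] [HasZeroObject T] [HasShift T ℤ]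
  [∀ n : ℤ, (shiftFunctor T n).Additive] [Pretriangulated T]

/-- `T` is equivalent to `perf(A)` as a `ℂ`-linear triangulated category: there is a fully
faithful `ℂ`-linear exact functor from `T` to the homotopy category of dg modules whose essential
image consists of the perfect objects. -/
def IsEquivalentToPerf [Linear ℂ T] (A : DGAlgebra.{u}) : Prop :=
  ∃ (F : T ⥤ HoDGMod A) (_ : F.CommShift ℤ),
    F.Full ∧ F.Faithful ∧ F.Additive ∧ F.Linear ℂ ∧
    (∀ Δ ∈ distTriang T, F.mapTriangle.obj Δ ∈ HoDGMod.distinguished A) ∧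
    ∀ M : HoDGMod A, F.essImage M ↔ M.IsPerfect

/-- The Grothendieck group `K(T)`: generated by the objects, with `[Y] = [X] + [Z]` for each
distinguished triangle `X ⟶ Y ⟶ Z ⟶ X[1]`. -/
abbrev K₀ := FreeAbelianGroup T ⧸ AddSubgroup.closure {x : FreeAbelianGroup T |
  ∃ Δ ∈ distTriang T, x = FreeAbelianGroup.of Δ.obj₂ -
    (FreeAbelianGroup.of Δ.obj₁ + FreeAbelianGroup.of Δ.obj₃)}

variable {T} in
/-- The class of an object in `K(T)`. -/
def K₀.of (E : T) : K₀ T := QuotientAddGroup.mk (FreeAbelianGroup.of E)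

/-- `T` is connected: it has no nontrivial orthogonal decompositions. An orthogonal decomposition
consists of two full triangulated subcategories `P` and `Q` without nonzero morphisms between them
in either direction, such that every object is an extension of an object of `Q` by an object of
`P`; it is trivial if `P` or `Q` is zero. -/
def IsConnected : Prop :=
  ∀ P Q : ObjectProperty T, P.IsTriangulated → P.IsClosedUnderIsomorphisms →
    Q.IsTriangulated → Q.IsClosedUnderIsomorphisms →
    (∀ X Y, P X → Q Y → (∀ f : X ⟶ Y, f = 0) ∧ ∀ f : Y ⟶ X, f = 0) →
    (∀ E, ∃ Δ ∈ distTriang T, P Δ.obj₁ ∧ Δ.obj₂ = E ∧ Q Δ.obj₃) →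
    (∀ X, P X → IsZero X) ∨ ∀ Y, Q Y → IsZero Y

/-- A stability condition on `T` with respect to `(Λ, v)`, where the support property is measured
by the norm `nrm` on `Λ ⊗ ℝ`. -/
structure StabilityCondition {Λ : Type*} [AddCommGroup Λ] (v : K₀ T →+ Λ)
    (nrm : Seminorm ℝ (ℝ ⊗[ℤ] Λ)) where
  /-- the central charge -/
  Z : Λ →+ ℂ
  /-- the slicing: `P φ` is a full additive subcategory for each `φ` -/
  P : ℝ → ObjectProperty T
  closedUnderIso : ∀ φ, (P φ).IsClosedUnderIsomorphisms
  zero_mem : ∀ φ X, IsZero X → P φ X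
  sum_mem : ∀ φ (X Y : T) (b : BinaryBicone X Y), b.IsBilimit → P φ X → P φ Y → P φ b.pt
  charge : ∀ φ E, P φ E → ¬ IsZero E → ∃ m : ℝ, 0 < m ∧
    Z (v (K₀.of E)) = m * Complex.exp (Complex.I * Real.pi * φ)
  shift_iff : ∀ φ E, P (φ + 1) (E⟦(1 : ℤ)⟧) ↔ P φ E
  hom_zero : ∀ φ₁ φ₂ E₁ E₂, φ₂ < φ₁ → P φ₁ E₁ → P φ₂ E₂ → ∀ f : E₁ ⟶ E₂, f = 0
  /-- existence of Harder–Narasimhan filtrations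
  `0 = X 0 ⟶ X 1 ⟶ ⋯ ⟶ X p = E` with semistable factors `F i` of decreasing phases -/
  harderNarasimhan : ∀ E : T, ¬ IsZero E → ∃ (p : ℕ) (X : Fin (p + 1) → T) (F : Fin p → T)
    (φ : Fin p → ℝ), IsZero (X 0) ∧ X (Fin.last p) = E ∧ StrictAnti φ ∧
    ∀ i, P (φ i) (F i) ∧ ∃ (f : X i.castSucc ⟶ X i.succ) (g : X i.succ ⟶ F i)
      (h : F i ⟶ (X i.castSucc)⟦(1 : ℤ)⟧), Triangle.mk f g h ∈ distTriang T
  support : ∃ C : ℝ, 0 < C ∧ ∀ φ E, P φ E → ¬ IsZero E →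
    nrm (1 ⊗ₜ v (K₀.of E)) < C * ‖Z (v (K₀.of E))‖

variable {T}

/-- The global dimension of a stability condition: the supremum of all `φ₂ - φ₁` such that there
is a nonzero morphism from an object of `P φ₁` to an object of `P φ₂`. (All these differences are
nonnegative.) -/
def StabilityCondition.gldim {Λ : Type*} [AddCommGroup Λ] {v : K₀ T →+ Λ}
    {nrm : Seminorm ℝ (ℝ ⊗[ℤ] Λ)} (σ : StabilityCondition T v nrm) : ENNReal :=
  sSup {x | ∃ (φ₁ φ₂ : ℝ) (E₁ E₂ : T), σ.P φ₁ E₁ ∧ σ.P φ₂ E₂ ∧ (∃ f : E₁ ⟶ E₂, f ≠ 0) ∧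
    x = ENNReal.ofReal (φ₂ - φ₁)}

/-- `E` is exceptional: `Hom(E, E) = ℂ` and `Hom(E, E[k]) = 0` for `k ≠ 0`. -/
def IsExceptional [Linear ℂ T] (E : T) : Prop :=
  Module.finrank ℂ (E ⟶ E) = 1 ∧ ∀ k : ℤ, k ≠ 0 → ∀ f : E ⟶ E⟦k⟧, f = 0

/-- An exceptional collection: exceptional objects with no morphisms, in any degree, from later
objects to earlier ones. -/
def IsExceptionalCollection [Linear ℂ T] {n : ℕ} (E : Fin n → T) : Prop :=
  (∀ i, IsExceptional (E i)) ∧ ∀ i j, i < j → ∀ (k : ℤ) (f : E j ⟶ (E i)⟦k⟧), f = 0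

/-- The collection is strong: there are no morphisms of nonzero degree between its members. -/
def IsStrong {n : ℕ} (E : Fin n → T) : Prop :=
  ∀ i j, ∀ k : ℤ, k ≠ 0 → ∀ f : E i ⟶ (E j)⟦k⟧, f = 0

/-- The collection is full: the smallest full triangulated subcategory containing it is `T`. -/
def IsFull {n : ℕ} (E : Fin n → T) : Prop :=
  ∀ P : ObjectProperty T, P.IsTriangulated → P.IsClosedUnderIsomorphisms →
    (∀ i, P (E i)) → ∀ X, P X

end Triangulated

end DGStab

end

noncomputable section

open scoped ZeroObject

universe u

set_option linter.unusedSectionVars false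

namespace DGStab

/-! ### Lattice points of bounded norm -/

/-! Along nonzero morphisms phases grow by at most some `d < 1`. The connecting maps of a
Harder–Narasimhan filtration would raise the phase by more than 1, so they vanish: every object is a
direct sum of semistable ones (`finSum_semistable`). The support property keeps masses away from 0,
so these split further into finitely many indecomposable semistable objects, called `Stable`.
Comparing central charges on a cone shows that a nonzero map between stable objects of equal phase
is invertible (`Stable.isIso`).

The exceptional collection consists of the injective stable objects of the heart P((0,1]), ordered
by phase. The phase bound leaves only Hom and Ext¹ between stable objects of the heart, injectivity
kills Ext¹ (`Inj.hom_shift`), and Schur's lemma gives the rest of exceptionality. There are enough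
injectives (`exists_inj`): among the stable objects of the heart that receive a nonzero map from X,
one of maximal phase is injective, because a nonsplit extension would produce a target of larger
phase.

The maximum exists because a stable object maps nontrivially to only finitely many stable objects
(`targets_finite`). Here the source is replaced by part of the fiber of one such map. This lowers
its charge in a fixed direction, which takes only finitely many values below a bound, so the process
stops. The same finiteness, applied to a generator of the category, shows that there are finitely
many injectives. For fullness (`mem_of_inj_mem`), a stable X in the heart is approximated by a sum
of injectives, and the cone is again a sum of injectives.

The dg algebra contributes finite-dimensional Hom spaces, by properness, and a generator, namely A
itself. Both come from induction along a semi-free basis. -/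

theorem finite_setOf_norm_tmul_le {Λ : Type*} [AddCommGroup Λ] [Module.Free ℤ Λ]
    [Module.Finite ℤ Λ] (nrm : Seminorm ℝ (ℝ ⊗[ℤ] Λ)) (hnrm : ∀ x, nrm x = 0 → x = 0) (R : ℝ) :
    {l : Λ | nrm (1 ⊗ₜ l) ≤ R}.Finite := by
  let b := Module.Free.chooseBasis ℤ Λ
  let B := Algebra.TensorProduct.basis ℝ b
  let _ : Norm (ℝ ⊗[ℤ] Λ) := ⟨nrm⟩
  have core : NormedSpace.Core ℝ (ℝ ⊗[ℤ] Λ) :=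
    { norm_nonneg := fun x => apply_nonneg nrm x
      norm_smul := fun c x => map_smul_eq_mul nrm c x
      norm_triangle := fun x y => map_add_le_add nrm x y
      norm_eq_zero_iff := fun x => ⟨hnrm x, fun h => by subst h; exact map_zero nrm⟩ }
  let _ : NormedAddCommGroup (ℝ ⊗[ℤ] Λ) := NormedAddCommGroup.ofCore core
  let _ : NormedSpace ℝ (ℝ ⊗[ℤ] Λ) := NormedSpace.ofCore core
  have : FiniteDimensional ℝ (ℝ ⊗[ℤ] Λ) := B.finiteDimensional_of_finite
  let f : (ℝ ⊗[ℤ] Λ) →L[ℝ] (Module.Free.ChooseBasisIndex ℤ Λ → ℝ) :=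
    LinearMap.toContinuousLinearMap B.equivFun.toLinearMap
  -- The coordinate map is linear on a finite-dimensional normed space, hence bounded: the norm
  -- controls the integer coordinates.
  have key : ∀ l : Λ, nrm (1 ⊗ₜ l) ≤ R → ∀ i, |b.repr l i| ≤ ⌈‖f‖ * R⌉ := by
    intro l hl i
    have h1 : ‖f (1 ⊗ₜ l)‖ ≤ ‖f‖ * R := (f.le_opNorm _).trans
      (mul_le_mul_of_nonneg_left hl (norm_nonneg _))
    have h2 := (norm_le_pi_norm (f (1 ⊗ₜ l)) i).trans h1
    have h3 : f (1 ⊗ₜ l) i = (b.repr l i : ℝ) := by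
      simp [f, B, Algebra.TensorProduct.basis_repr_tmul]
    rw [h3, Real.norm_eq_abs, ← Int.cast_abs] at h2
    exact_mod_cast h2.trans (Int.le_ceil _)
  have hfin : (Set.pi Set.univ fun _ : Module.Free.ChooseBasisIndex ℤ Λ =>
      Set.Icc (-⌈‖f‖ * R⌉) ⌈‖f‖ * R⌉).Finite := by
    simpa [Set.pi] using Set.Finite.pi' fun _ : Module.Free.ChooseBasisIndex ℤ Λ =>
      Set.finite_Icc (-⌈‖f‖ * R⌉) ⌈‖f‖ * R⌉
  refine Set.Finite.of_finite_image (f := b.equivFun) (hfin.subset ?_) b.equivFun.injective.injOn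
  rintro _ ⟨l, hl, rfl⟩ i -
  exact abs_le.1 (key l hl i)

/-! ### Generalities on triangulated categories -/

section Triangulated

variable {T : Type*} [Category T] [Preadditive T] [HasZeroObject T] [HasShift T ℤ]
  [∀ n : ℤ, (shiftFunctor T n).Additive] [Pretriangulated T]

theorem K₀.of_add {Δ : Triangle T} (h : Δ ∈ distTriang T) :
    K₀.of Δ.obj₂ = K₀.of Δ.obj₁ + K₀.of Δ.obj₃ := by
  unfold K₀.of
  rw [← QuotientAddGroup.mk_add, QuotientAddGroup.eq_iff_sub_mem]
  exact AddSubgroup.subset_closure ⟨Δ, h, rfl⟩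

theorem K₀.of_isZero {X : T} (h : IsZero X) : K₀.of X = 0 := by
  have := K₀.of_add (Δ := Triangle.mk (0 : X ⟶ X) (0 : X ⟶ X) 0) (by
    rw [Triangle.distinguished_iff_of_isZero₃ _ h]
    exact ⟨0, h.eq_of_src _ _, h.eq_of_src _ _⟩)
  simpa using this

theorem K₀.of_iso {X Y : T} (e : X ≅ Y) : K₀.of X = K₀.of Y := by
  obtain ⟨Z, g, h, hΔ⟩ := distinguished_cocone_triangle e.hom
  have hz : IsZero Z := Triangle.isZero₃_of_isIso₁ _ hΔ (inferInstanceAs (IsIso e.hom))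
  have h1 := K₀.of_add hΔ
  simpa [K₀.of_isZero hz] using h1.symm

theorem K₀.of_biprod (X Y : T) : K₀.of (X ⊞ Y) = K₀.of X + K₀.of Y :=
  K₀.of_add (binaryBiproductTriangle_distinguished X Y)

def retractBiprodLeft (X Y : T) : Retract X (X ⊞ Y) := ⟨biprod.inl, biprod.fst, biprod.inl_fst⟩

def retractBiprodRight (X Y : T) : Retract Y (X ⊞ Y) := ⟨biprod.inr, biprod.snd, biprod.inr_snd⟩

section Exactness

variable {X Y C W : T} {f : X ⟶ Y} {g : Y ⟶ C} {t : C ⟶ X⟦(1 : ℤ)⟧}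
  (h : Triangle.mk f g t ∈ distTriang T)
include h

theorem exists_eq_comp₂ (a : Y ⟶ W) (ha : f ≫ a = 0) : ∃ u : C ⟶ W, a = g ≫ u :=
  Triangle.yoneda_exact₂ _ h a ha

theorem exists_eq_comp₃ (a : C ⟶ W) (ha : g ≫ a = 0) : ∃ u : X⟦(1 : ℤ)⟧ ⟶ W, a = t ≫ u :=
  Triangle.yoneda_exact₃ _ h a ha

theorem exists_lift₁ (a : W ⟶ X⟦(1 : ℤ)⟧) (ha : a ≫ f⟦(1 : ℤ)⟧' = 0) : ∃ u : W ⟶ C, a = u ≫ t :=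
  Triangle.coyoneda_exact₁ _ h a ha

theorem exists_lift₂ (a : W ⟶ Y) (ha : a ≫ g = 0) : ∃ u : W ⟶ X, a = u ≫ f :=
  Triangle.coyoneda_exact₂ _ h a ha

theorem exists_lift₃ (a : W ⟶ C) (ha : a ≫ t = 0) : ∃ u : W ⟶ Y, a = u ≫ g :=
  Triangle.coyoneda_exact₃ _ h a ha

theorem comp_eq_zero₁₂ : f ≫ g = 0 := comp_distTriang_mor_zero₁₂ _ h

theorem comp_eq_zero₂₃ : g ≫ t = 0 := comp_distTriang_mor_zero₂₃ _ h

theorem comp_eq_zero₃₁ : t ≫ f⟦(1 : ℤ)⟧' = 0 := comp_distTriang_mor_zero₃₁ _ h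

end Exactness

/-- For a triangle `K ⟶ L ⟶ Y ⟶ K[1]`, the retracts of `K[1]` on which the map to `L[1]` vanishes
come from retracts of `Y`. -/
theorem exists_retract_of_comp_eq_zero {K L Y W : T} {f : K ⟶ L} {g : L ⟶ Y}
    {t : Y ⟶ K⟦(1 : ℤ)⟧} (h : Triangle.mk f g t ∈ distTriang T)
    (r : Retract W (K⟦(1 : ℤ)⟧)) (h0 : r.i ≫ f⟦(1 : ℤ)⟧' = 0) :
    ∃ s : Retract W Y, g ≫ s.r = 0 := by
  obtain ⟨u, hu⟩ := exists_lift₁ h _ h0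
  refine ⟨⟨u, t ≫ r.r, ?_⟩, ?_⟩
  · rw [← Category.assoc, ← hu, r.retract]
  · rw [← Category.assoc, comp_eq_zero₂₃ h, zero_comp]

theorem biprod_triangle_distinguished {E X Y : T} (e : E ≅ X ⊞ Y) :
    Triangle.mk (biprod.inl ≫ e.inv) (e.hom ≫ biprod.snd) (0 : Y ⟶ X⟦(1 : ℤ)⟧) ∈ distTriang T := by
  refine isomorphic_distinguished _ (binaryBiproductTriangle_distinguished X Y) _ ?_
  refine Triangle.isoMk _ _ (Iso.refl _) e (Iso.refl _) ?_ ?_ ?_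
  · change (biprod.inl ≫ e.inv) ≫ e.hom = 𝟙 X ≫ biprod.inl
    simp
  · change (e.hom ≫ biprod.snd) ≫ 𝟙 Y = e.hom ≫ biprod.snd
    simp
  · exact zero_comp.trans comp_zero.symm

/-! ### Finite direct sums of objects from a class -/

/-- `E` is a finite direct sum of objects satisfying `Q`. -/
inductive FinSum (Q : T → Prop) : T → Prop
  | zero (E : T) : IsZero E → FinSum Q E
  | add (X Y E : T) : Q X → FinSum Q Y → (E ≅ X ⊞ Y) → FinSum Q E

namespace FinSum

variable {Q Q' : T → Prop} {E E' : T}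

theorem of_iso (h : FinSum Q E) (e : E' ≅ E) : FinSum Q E' := by
  cases h with
  | zero _ h => exact zero _ (h.of_iso e)
  | add X Y _ hX hY e' => exact add X Y _ hX hY (e ≪≫ e')

theorem mono (h : FinSum Q E) (hQ : ∀ X, Q X → Q' X) : FinSum Q' E := by
  induction h with
  | zero _ h => exact zero _ h
  | add X Y _ hX _ e ih => exact add X Y _ (hQ X hX) ih e

theorem of_isZero_biprod {X Y : T} (h : IsZero X) : Nonempty (X ⊞ Y ≅ Y) :=
  ⟨⟨biprod.snd, biprod.inr, by
    ext
    all_goals first | exact h.eq_of_src _ _ | simp, biprod.inr_snd⟩⟩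

/-- Associativity of the biproduct. -/
def biprodAssoc (X Y Z : T) : (X ⊞ Y) ⊞ Z ≅ X ⊞ (Y ⊞ Z) where
  hom := biprod.desc (biprod.map (𝟙 X) biprod.inl) (biprod.inr ≫ biprod.inr)
  inv := biprod.desc (biprod.inl ≫ biprod.inl) (biprod.map biprod.inr (𝟙 Z))
  hom_inv_id := by ext <;> simp
  inv_hom_id := by ext <;> simp

theorem biprod {F : T} (h : FinSum Q E) (h' : FinSum Q F) : FinSum Q (E ⊞ F) := by
  induction h with
  | zero E h => exact h'.of_iso (of_isZero_biprod h).some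
  | add X Y E hX _ e ih =>
    exact add X (Y ⊞ F) _ hX ih (biprod.mapIso e (Iso.refl F) ≪≫ biprodAssoc X Y F)

theorem single (h : Q E) : FinSum Q E :=
  add E 0 _ h (zero _ (isZero_zero T))
    ⟨biprod.inl, biprod.fst, biprod.inl_fst, by
      ext
      all_goals first | exact (isZero_zero T).eq_of_src _ _ | simp⟩

theorem bind (h : FinSum Q E) (hQ : ∀ X, Q X → FinSum Q' X) : FinSum Q' E := by
  induction h with
  | zero _ h => exact zero _ h
  | add X Y _ hX _ e ih => exact ((hQ X hX).biprod ih).of_iso e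

/-- The summands may be taken to be retracts. -/
theorem with_retract (h : FinSum Q E) : FinSum (fun W => Q W ∧ Nonempty (Retract W E)) E := by
  induction h with
  | zero _ h => exact zero _ h
  | add X Y E hX _ e ih =>
    refine add X Y E ⟨hX, ⟨(retractBiprodLeft X Y).trans (.ofIso e.symm)⟩⟩ (ih.mono ?_) e
    rintro W ⟨hW, ⟨r⟩⟩
    exact ⟨hW, ⟨(r.trans (retractBiprodRight X Y)).trans (.ofIso e.symm)⟩⟩

/-- Zero summands may be omitted. -/
theorem ne_zero (h : FinSum Q E) : FinSum (fun W => Q W ∧ ¬ IsZero W) E := by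
  induction h with
  | zero _ h => exact zero _ h
  | add X Y E hX _ e ih =>
    by_cases h0 : IsZero X
    · exact ih.of_iso (e ≪≫ (of_isZero_biprod h0).some)
    · exact add X Y E ⟨hX, h0⟩ ih e

/-- A morphism into a sum is detected by its components. Keeping the summand as a retract lets later
arguments work with one semistable piece at a time. -/
theorem exists_comp_r_ne_zero (h : FinSum Q E) {A : T} (f : A ⟶ E) (hf : f ≠ 0) :
    ∃ W, Q W ∧ ∃ r : Retract W E, f ≫ r.r ≠ 0 := by
  induction h generalizing A with
  | zero _ h => exact absurd (h.eq_of_tgt _ _) hf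
  | add X Y E hX _ e ih =>
    by_cases h1 : f ≫ e.hom ≫ biprod.fst = 0
    · have h2 : f ≫ e.hom ≫ biprod.snd ≠ 0 := by
        intro h2
        apply hf
        rw [← cancel_mono e.hom, zero_comp]
        ext <;> simp [h1, h2]
      obtain ⟨W, hW, r, hr⟩ := ih _ h2
      exact ⟨W, hW, (r.trans (retractBiprodRight X Y)).trans (.ofIso e.symm),
        by simpa [retractBiprodRight, Retract.ofIso] using hr⟩
    · exact ⟨X, hX, (retractBiprodLeft X Y).trans (.ofIso e.symm),
        by simpa [retractBiprodLeft, Retract.ofIso] using h1⟩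

theorem exists_i_comp_ne_zero (h : FinSum Q E) {A : T} (f : E ⟶ A) (hf : f ≠ 0) :
    ∃ W, Q W ∧ ∃ r : Retract W E, r.i ≫ f ≠ 0 := by
  induction h generalizing A with
  | zero _ h => exact absurd (h.eq_of_src _ _) hf
  | add X Y E hX _ e ih =>
    by_cases h1 : biprod.inl ≫ e.inv ≫ f = 0
    · have h2 : biprod.inr ≫ e.inv ≫ f ≠ 0 := by
        intro h2
        apply hf
        rw [← cancel_epi e.inv, comp_zero]
        ext <;> simp [h1, h2]
      obtain ⟨W, hW, r, hr⟩ := ih _ h2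
      exact ⟨W, hW, (r.trans (retractBiprodRight X Y)).trans (.ofIso e.symm),
        by simpa [retractBiprodRight, Retract.ofIso] using hr⟩
    · exact ⟨X, hX, (retractBiprodLeft X Y).trans (.ofIso e.symm),
        by simpa [retractBiprodLeft, Retract.ofIso] using h1⟩

theorem shift (h : FinSum Q E) (n : ℤ) :
    FinSum (fun W => ∃ V, Q V ∧ Nonempty (W ≅ V⟦n⟧)) (E⟦n⟧) := by
  induction h with
  | zero _ h =>
    refine zero _ ?_
    rw [IsZero.iff_id_eq_zero, ← CategoryTheory.Functor.map_id, h.eq_of_src (𝟙 _) 0, Functor.map_zero]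
  | add X Y E hX _ e ih =>
    have := preservesBinaryBiproduct_of_preservesBiproduct (shiftFunctor T n) X Y
    exact add _ _ _ ⟨X, hX, ⟨Iso.refl _⟩⟩ ih
      ((shiftFunctor T n).mapIso e ≪≫ (shiftFunctor T n).mapBiprod X Y)

/-- A class of objects containing zero objects and closed under isomorphisms and binary sums is
closed under finite direct sums. -/
theorem closed (h : FinSum Q E) (h0 : ∀ X, IsZero X → Q X)
    (hi : ∀ X Y : T, (X ≅ Y) → Q Y → Q X) (ha : ∀ X Y, Q X → Q Y → Q (X ⊞ Y)) : Q E := by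
  induction h with
  | zero _ h => exact h0 _ h
  | add X Y E hX _ e ih => exact hi _ _ e (ha _ _ hX ih)

/-- A sum of objects from two classes splits. -/
theorem split {Q₁ Q₂ : T → Prop} (h : FinSum Q E) (hQ : ∀ X, Q X → Q₁ X ∨ Q₂ X) :
    ∃ E₁ E₂, Nonempty (E ≅ E₁ ⊞ E₂) ∧ FinSum Q₁ E₁ ∧ FinSum Q₂ E₂ := by
  induction h with
  | zero E h =>
    exact ⟨E, E, ⟨(of_isZero_biprod h).some.symm⟩, zero _ h, zero _ h⟩
  | add X Y E hX _ e ih =>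
    obtain ⟨E₁, E₂, ⟨e'⟩, h₁, h₂⟩ := ih
    rcases hQ X hX with h | h
    · exact ⟨X ⊞ E₁, E₂, ⟨e ≪≫ biprod.mapIso (Iso.refl X) e' ≪≫ (biprodAssoc _ _ _).symm⟩,
        add X E₁ _ h h₁ (Iso.refl _), h₂⟩
    · exact ⟨E₁, X ⊞ E₂, ⟨e ≪≫ biprod.mapIso (Iso.refl X) e' ≪≫ (biprodAssoc _ _ _).symm ≪≫
        biprod.mapIso (biprod.braiding _ _) (Iso.refl _) ≪≫ biprodAssoc _ _ _⟩, h₁,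
        add X E₂ _ h h₂ (Iso.refl _)⟩

end FinSum

/-! ### Semistable objects -/

namespace StabilityCondition

variable {Λ : Type*} [AddCommGroup Λ] {v : K₀ T →+ Λ} {nrm : Seminorm ℝ (ℝ ⊗[ℤ] Λ)}
  (σ : StabilityCondition T v nrm)

/-- `d` bounds the differences of phases along nonzero morphisms. -/
def BoundedBy (d : ℝ) : Prop := ∀ ⦃φ₁ φ₂ : ℝ⦄ ⦃E₁ E₂ : T⦄, σ.P φ₁ E₁ → σ.P φ₂ E₂ →
  ∀ f : E₁ ⟶ E₂, f ≠ 0 → φ₂ ≤ φ₁ + d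

theorem exists_boundedBy (h : σ.gldim < 1) : ∃ d : ℝ, 0 ≤ d ∧ d < 1 ∧ σ.BoundedBy d := by
  refine ⟨σ.gldim.toReal, ENNReal.toReal_nonneg, ?_, ?_⟩
  · simpa using (ENNReal.toReal_lt_toReal (h.trans_le le_top).ne ENNReal.one_ne_top).2 h
  · intro φ₁ φ₂ E₁ E₂ h₁ h₂ f hf
    -- Truncating negative differences to 0 in `ENNReal.ofReal` is harmless for an upper bound.
    have h3 : ENNReal.ofReal (φ₂ - φ₁) ≤ σ.gldim := le_sSup ⟨φ₁, φ₂, E₁, E₂, h₁, h₂, ⟨f, hf⟩, rfl⟩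
    have := (ENNReal.ofReal_le_iff_le_toReal (h.trans_le le_top).ne).1 h3
    linarith

/-- The central charge of an object. -/
def ch (E : T) : ℂ := σ.Z (v (K₀.of E))

variable {σ}

theorem ch_add {Δ : Triangle T} (h : Δ ∈ distTriang T) :
    σ.ch Δ.obj₂ = σ.ch Δ.obj₁ + σ.ch Δ.obj₃ := by
  simp [ch, K₀.of_add h]

theorem ch_isZero {E : T} (h : IsZero E) : σ.ch E = 0 := by simp [ch, K₀.of_isZero h]

theorem ch_iso {E F : T} (e : E ≅ F) : σ.ch E = σ.ch F := by simp [ch, K₀.of_iso e]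

theorem ch_biprod (E F : T) : σ.ch (E ⊞ F) = σ.ch E + σ.ch F := by simp [ch, K₀.of_biprod]

theorem P_iso {φ : ℝ} {E F : T} (e : E ≅ F) (h : σ.P φ F) : σ.P φ E :=
  have := σ.closedUnderIso φ
  (σ.P φ).prop_of_iso e.symm h

theorem P_biprod {φ : ℝ} {E F : T} (hE : σ.P φ E) (hF : σ.P φ F) : σ.P φ (E ⊞ F) :=
  σ.sum_mem φ E F _ (BinaryBiproduct.isBilimit E F) hE hF

theorem P_of_finSum {φ : ℝ} {E : T} (h : FinSum (σ.P φ) E) : σ.P φ E :=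
  h.closed (σ.zero_mem φ) (fun _ _ e h => P_iso e h) fun _ _ => P_biprod

theorem P_shift {φ : ℝ} {E : T} (h : σ.P φ E) (n : ℤ) : σ.P (φ + n) (E⟦n⟧) := by
  induction n using Int.induction_on with
  | zero => simpa using P_iso ((shiftFunctorZero T ℤ).app E) h
  | succ n ih =>
    have := P_iso ((shiftFunctorAdd T (n : ℤ) 1).app E) ((σ.shift_iff _ _).2 ih)
    push_cast at this ⊢
    rwa [← add_assoc]
  | pred n ih =>
    have e : (E⟦(-n - 1 : ℤ)⟧)⟦(1 : ℤ)⟧ ≅ E⟦(-n : ℤ)⟧ :=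
      ((shiftFunctorAdd' T (-n - 1 : ℤ) 1 (-n) (by ring)).app E).symm
    refine (σ.shift_iff _ _).1 (P_iso e ?_)
    push_cast at ih ⊢
    convert ih using 1
    ring

/-- Every object is a finite direct sum of nonzero semistable objects. -/
theorem finSum_semistable {d : ℝ} (hd : d < 1) (hσ : σ.BoundedBy d) (E : T) :
    FinSum (fun W => (∃ φ, σ.P φ W) ∧ ¬ IsZero W) E := by
  by_cases hE : IsZero E
  · exact .zero _ hE
  obtain ⟨p, X, F, φ, h0, rfl, hφ, h⟩ := σ.harderNarasimhan E hE
  have key : ∀ i : Fin (p + 1), FinSum (fun W => ∃ j : Fin p, j.castSucc < i ∧ σ.P (φ j) W)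
      (X i) := by
    intro i
    induction i using Fin.induction with
    | zero => exact .zero _ h0
    | succ i ih =>
      obtain ⟨hF, f, g, t, hΔ⟩ := h i
      -- The summands of `X i.castSucc` have phases above that of `F i`. After the shift the gap
      -- exceeds `1 > d`, so the connecting map vanishes and the triangle splits.
      have ht : t = 0 := by
        by_contra hne
        obtain ⟨W, ⟨V, ⟨j, hj, hV⟩, ⟨e⟩⟩, r, hr⟩ := (ih.shift 1).exists_comp_r_ne_zero t hne
        have := hσ hF (P_iso e (by simpa using P_shift hV 1)) _ hr
        have := hφ (show j < i from hj)
        linarith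
      obtain ⟨e, -, -⟩ := exists_iso_binaryBiproduct_of_distTriang _ hΔ ht
      refine .of_iso (.biprod (ih.mono ?_) (.single ⟨i, Fin.castSucc_lt_succ, hF⟩)) e
      rintro W ⟨j, hj, hW⟩
      exact ⟨j, hj.trans Fin.castSucc_lt_succ, hW⟩
  exact ((key (Fin.last p)).mono fun W ⟨j, _, hW⟩ => ⟨φ j, hW⟩).ne_zero

/-- A nonzero semistable piece of `W` is a retract of `E`, so it has nonzero maps to and from `E`.
These force its phase to be `φ`. -/
theorem P_of_retract {d : ℝ} (hd : d < 1) (hσ : σ.BoundedBy d) {φ : ℝ} {E W : T} (r : Retract W E)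
    (h : σ.P φ E) : σ.P φ W := by
  refine P_of_finSum ((finSum_semistable hd hσ W).with_retract.mono ?_)
  rintro V ⟨⟨⟨ψ, hV⟩, hV0⟩, ⟨s⟩⟩
  rw [IsZero.iff_id_eq_zero, ← (s.trans r).retract] at hV0
  have h1 : φ ≤ ψ := by
    by_contra hlt
    exact hV0 (by rw [σ.hom_zero _ _ _ _ (not_le.1 hlt) h hV (s.trans r).r, comp_zero])
  have h2 : ψ ≤ φ := by
    by_contra hlt
    exact hV0 (by rw [σ.hom_zero _ _ _ _ (not_le.1 hlt) hV h (s.trans r).i, zero_comp])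
  rwa [le_antisymm h1 h2]

/-- The component of the central charge in the direction of phase `θ`. -/
def len (σ : StabilityCondition T v nrm) (θ : ℝ) (E : T) : ℝ :=
  (σ.ch E * Complex.exp (-(Complex.I * Real.pi * θ))).re

theorem len_add (θ : ℝ) {Δ : Triangle T} (h : Δ ∈ distTriang T) :
    σ.len θ Δ.obj₂ = σ.len θ Δ.obj₁ + σ.len θ Δ.obj₃ := by
  simp only [len, ch_add h, add_mul, Complex.add_re]

theorem len_isZero (θ : ℝ) {E : T} (h : IsZero E) : σ.len θ E = 0 := by simp [len, ch_isZero h]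

theorem len_iso (θ : ℝ) {E F : T} (e : E ≅ F) : σ.len θ E = σ.len θ F := by simp [len, ch_iso e]

theorem len_biprod (θ : ℝ) (E F : T) : σ.len θ (E ⊞ F) = σ.len θ E + σ.len θ F := by
  simp only [len, ch_biprod, add_mul, Complex.add_re]

theorem ch_eq_norm_mul {φ : ℝ} {E : T} (h : σ.P φ E) (h0 : ¬ IsZero E) :
    0 < ‖σ.ch E‖ ∧ σ.ch E = ‖σ.ch E‖ * Complex.exp (Complex.I * Real.pi * φ) := by
  obtain ⟨m, hm, h⟩ := σ.charge φ E h h0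
  have : ‖σ.ch E‖ = m := by
    rw [ch, h, norm_mul, show Complex.I * Real.pi * φ = ((Real.pi * φ : ℝ) : ℂ) * Complex.I by
      push_cast; ring, Complex.norm_exp_ofReal_mul_I, mul_one, Complex.norm_real,
      Real.norm_of_nonneg hm.le]
  exact ⟨this ▸ hm, by rw [this]; exact h⟩

theorem len_eq {φ : ℝ} {E : T} (h : σ.P φ E) (h0 : ¬ IsZero E) (θ : ℝ) :
    σ.len θ E = ‖σ.ch E‖ * Real.cos (Real.pi * (φ - θ)) := by
  rw [len, (ch_eq_norm_mul h h0).2, mul_assoc, ← Complex.exp_add,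
    show Complex.I * Real.pi * φ + -(Complex.I * Real.pi * θ) =
      ((Real.pi * (φ - θ) : ℝ) : ℂ) * Complex.I by push_cast; ring, Complex.re_ofReal_mul,
    Complex.exp_ofReal_mul_I_re, ← (ch_eq_norm_mul h h0).2]

theorem len_nonneg {θ : ℝ} {E : T}
    (h : FinSum (fun W => ∃ φ, |φ - θ| ≤ 1 / 2 ∧ σ.P φ W) E) : 0 ≤ σ.len θ E := by
  induction h with
  | zero _ h => rw [len_isZero θ h]
  | add X Y E hX _ e ih =>
    obtain ⟨φ, hφ, hX⟩ := hX
    rw [len_iso θ e, len_biprod]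
    refine add_nonneg ?_ ih
    by_cases h0 : IsZero X
    · rw [len_isZero θ h0]
    rw [abs_le] at hφ
    rw [len_eq hX h0]
    have := Real.pi_pos
    exact mul_nonneg (norm_nonneg _) (Real.cos_nonneg_of_neg_pi_div_two_le_of_le (by nlinarith)
      (by nlinarith))

/-- If the pieces of `E` have phases in `[φ, φ + 1]` and the charge of `E` is real in the direction
of `φ`, then the phases are `φ` and `φ + 1`. -/
theorem finSum_ends {φ : ℝ} {E : T}
    (h : FinSum (fun W => ∃ ψ, |ψ - (φ + 1 / 2)| ≤ 1 / 2 ∧ σ.P ψ W) E)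
    (h0 : σ.len (φ + 1 / 2) E = 0) : FinSum (fun W => σ.P φ W ∨ σ.P (φ + 1) W) E := by
  induction h with
  | zero _ h => exact .zero _ h
  | add X Y E hX hY e ih =>
    rw [len_iso _ e, len_biprod] at h0
    have h1 := len_nonneg (.single hX)
    have h2 := len_nonneg hY
    obtain ⟨ψ, hψ, hX⟩ := hX
    refine .add X Y E ?_ (ih (by linarith)) e
    by_cases hz : IsZero X
    · exact Or.inl (σ.zero_mem _ _ hz)
    have h3 : σ.len (φ + 1 / 2) X = 0 := by linarith
    rw [len_eq hX hz] at h3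
    have h4 := (mul_eq_zero.1 h3).resolve_left (ch_eq_norm_mul hX hz).1.ne'
    rw [abs_le] at hψ
    by_cases ha : ψ = φ
    · exact Or.inl (ha ▸ hX)
    by_cases hb : ψ = φ + 1
    · exact Or.inr (hb ▸ hX)
    have h5 : φ < ψ := lt_of_le_of_ne (by linarith) (Ne.symm ha)
    have h6 : ψ < φ + 1 := lt_of_le_of_ne (by linarith) hb
    have := Real.pi_pos
    exact absurd h4 (Real.cos_pos_of_mem_Ioo ⟨by nlinarith, by nlinarith⟩).ne'

/-! ### Stable objects -/

/-- Indecomposable semistable objects. -/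
structure Stable (σ : StabilityCondition T v nrm) (φ : ℝ) (X : T) : Prop where
  mem : σ.P φ X
  ne_zero : ¬ IsZero X
  isIso_of_retract : ∀ ⦃W : T⦄ (r : Retract W X), ¬ IsZero W → IsIso r.i

theorem isIso_r {X Y : T} (r : Retract X Y) (h : IsIso r.i) : IsIso r.r := by
  rw [IsIso.eq_inv_of_hom_inv_id r.retract]
  infer_instance

theorem Stable.shift {φ : ℝ} {X : T} (h : σ.Stable φ X) (n : ℤ) : σ.Stable (φ + n) (X⟦n⟧) where
  mem := P_shift h.mem n
  ne_zero h0 := h.ne_zero (by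
    rw [IsZero.iff_id_eq_zero]
    apply (shiftFunctor T n).map_injective
    exact h0.eq_of_src _ _)
  isIso_of_retract W r hW := by
    let e : (X⟦n⟧)⟦-n⟧ ≅ X := (shiftFunctorCompIsoId T n (-n) (by simp)).app X
    have h1 := h.isIso_of_retract ((r.map (shiftFunctor T (-n))).trans (.ofIso e)) (fun h0 => hW (by
      rw [IsZero.iff_id_eq_zero]
      apply (shiftFunctor T (-n)).map_injective
      exact h0.eq_of_src _ _))
    have h2 : (shiftFunctor T (-n)).map r.i =
        ((r.map (shiftFunctor T (-n))).trans (.ofIso e)).i ≫ e.inv := by simp [Retract.ofIso]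
    have h3 : IsIso ((shiftFunctor T (-n)).map r.i) := by rw [h2]; infer_instance
    exact isIso_of_reflects_iso r.i (shiftFunctor T (-n))

section Bounded

variable {d : ℝ} (hd : d < 1) (hσ : σ.BoundedBy d)
include hd hσ

/-- Schur's lemma. -/
theorem Stable.isIso {φ : ℝ} {X Y : T} (hX : σ.Stable φ X) (hY : σ.Stable φ Y) (f : X ⟶ Y)
    (hf : f ≠ 0) : IsIso f := by
  obtain ⟨C, g, t, hΔ⟩ := distinguished_cocone_triangle f
  have hX1 := hX.shift 1
  -- The long exact sequences confine the phases of the cone to `[φ, φ + 1]`. Its charge is a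
  -- difference of two numbers on the ray of phase `φ`, so nothing lies strictly in between.
  have key : FinSum (fun W => σ.P φ W ∨ σ.P (φ + 1) W) C := by
    refine finSum_ends ((finSum_semistable hd hσ C).with_retract.mono ?_) ?_
    · rintro W ⟨⟨⟨ψ, hW⟩, hW0⟩, ⟨r⟩⟩
      rw [IsZero.iff_id_eq_zero] at hW0
      refine ⟨ψ, ?_, hW⟩
      have h1 : φ ≤ ψ := by
        by_contra hlt
        rw [not_le] at hlt
        obtain ⟨u, hu⟩ := exists_eq_comp₃ hΔ r.r (σ.hom_zero _ _ _ _ hlt hY.mem hW _)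
        refine hW0 ?_
        rw [← r.retract, hu, σ.hom_zero _ _ _ _ (by push_cast; linarith) hX1.mem hW u]
        simp
      have h2 : ψ ≤ φ + 1 := by
        by_contra hlt
        rw [not_le] at hlt
        obtain ⟨u, hu⟩ := exists_lift₃ hΔ r.i
          (σ.hom_zero _ _ _ _ (by push_cast; linarith) hW hX1.mem _)
        refine hW0 ?_
        rw [← r.retract, hu, σ.hom_zero _ _ _ _ (by linarith) hW hY.mem u]
        simp
      rw [abs_le]
      constructor <;> linarith
    · have h1 : σ.len (φ + 1 / 2) Y = σ.len (φ + 1 / 2) X + σ.len (φ + 1 / 2) C :=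
        len_add (σ := σ) (φ + 1 / 2) hΔ
      have h2 : Real.cos (Real.pi * (φ - (φ + 1 / 2))) = 0 := by
        rw [show Real.pi * (φ - (φ + 1 / 2)) = -(Real.pi / 2) by ring, Real.cos_neg,
          Real.cos_pi_div_two]
      rw [len_eq hX.mem hX.ne_zero, len_eq hY.mem hY.ne_zero, h2] at h1
      linarith
  have hC : IsZero C := by
    by_contra hC
    rw [IsZero.iff_id_eq_zero] at hC
    obtain ⟨W, hW, r, hr⟩ := key.exists_comp_r_ne_zero (𝟙 C) hC
    have hW0 : ¬ IsZero W := fun h => hr (h.eq_of_tgt _ _)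
    rcases hW with hW | hW
    -- A piece of phase `φ` has no map to `X[1]`, as `d < 1`. It is then a retract of `Y`, hence all
    -- of `Y`, and `f` dies because `f ≫ g = 0`. The case of phase `φ + 1` is dual, with `X[1]` in
    -- place of `Y`.
    · obtain ⟨u, hu⟩ := exists_lift₃ hΔ r.i (by
        by_contra hne
        have := hσ hW hX1.mem _ hne
        push_cast at this
        linarith)
      let s : Retract W Y := ⟨u, g ≫ r.r, by rw [← Category.assoc, ← hu, r.retract]⟩
      have := isIso_r s (hY.isIso_of_retract s hW0)
      apply hf
      rw [← cancel_mono s.r, zero_comp]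
      change f ≫ g ≫ r.r = 0
      rw [← Category.assoc, comp_eq_zero₁₂ hΔ, zero_comp]
    · obtain ⟨u, hu⟩ := exists_eq_comp₃ hΔ r.r (by
        by_contra hne
        have := hσ hY.mem hW _ hne
        linarith)
      let s : Retract W (X⟦(1 : ℤ)⟧) := ⟨r.i ≫ t, u, by rw [Category.assoc, ← hu, r.retract]⟩
      have := hX1.isIso_of_retract s hW0
      apply hf
      apply (shiftFunctor T (1 : ℤ)).map_injective
      rw [← cancel_epi s.i, Functor.map_zero, comp_zero]
      change (r.i ≫ t) ≫ _ = 0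
      rw [Category.assoc, comp_eq_zero₃₁ hΔ, comp_zero]
  exact (Triangle.isZero₃_iff_isIso₁ _ hΔ).1 hC

/-- Charges of equal phase add without cancellation, so a splitting divides the mass. Each nonzero
part costs at least `c`, and the induction on the mass in units of `c` terminates. -/
theorem finSum_stable_of_P {c : ℝ} (hc : 0 < c)
    (hcσ : ∀ φ E, σ.P φ E → ¬ IsZero E → c ≤ ‖σ.ch E‖) {φ : ℝ} {E : T} (hE : σ.P φ E) :
    FinSum (σ.Stable φ) E := by
  have key : ∀ n : ℕ, ∀ E, σ.P φ E → ‖σ.ch E‖ ≤ n * c → FinSum (σ.Stable φ) E := by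
    intro n
    induction n with
    | zero =>
      intro E hE h
      refine .zero _ ?_
      by_contra h0
      have := hcσ _ _ hE h0
      simp at h
      rw [h, norm_zero] at this
      linarith
    | succ n ih =>
      intro E hE h
      by_cases h0 : IsZero E
      · exact .zero _ h0
      by_cases hs : σ.Stable φ E
      · exact .single hs
      obtain ⟨W, r, hW, hr⟩ : ∃ W, ∃ r : Retract W E, ¬ IsZero W ∧ ¬ IsIso r.i := by
        by_contra hne
        push Not at hne
        exact hs ⟨hE, h0, hne⟩
      obtain ⟨V, g, t, hΔ⟩ := distinguished_cocone_triangle r.i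
      have ht : t = 0 := Triangle.mor₃_eq_zero_of_mono₁ _ hΔ (show Mono r.i from inferInstance)
      obtain ⟨e, -, -⟩ := exists_iso_binaryBiproduct_of_distTriang _ hΔ ht
      replace e : E ≅ W ⊞ V := e
      have hV : ¬ IsZero V := fun hV => hr ((Triangle.isZero₃_iff_isIso₁ _ hΔ).1 hV)
      have hWP : σ.P φ W := P_of_retract hd hσ r hE
      have hVP : σ.P φ V := P_of_retract hd hσ
        ((retractBiprodRight W V).trans (.ofIso e.symm)) hE
      have hsum : ‖σ.ch E‖ = ‖σ.ch W‖ + ‖σ.ch V‖ := by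
        have h1 := len_eq (σ := σ) hE h0 φ
        have h2 := len_eq (σ := σ) hWP hW φ
        have h3 := len_eq (σ := σ) hVP hV φ
        rw [len_iso φ e, len_biprod] at h1
        simp at h1 h2 h3
        linarith
      have h1 := hcσ _ _ hWP hW
      have h2 := hcσ _ _ hVP hV
      push_cast at h
      exact ((ih W hWP (by linarith)).biprod (ih V hVP (by linarith))).of_iso e
  obtain ⟨n, hn⟩ := exists_nat_ge (‖σ.ch E‖ / c)
  exact key n E hE ((div_le_iff₀ hc).1 hn)

end Bounded

/-- By the support property, semistable classes of mass at most 1 lie in a ball, which has finitely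
many lattice points. -/
theorem exists_le_norm_ch [Module.Free ℤ Λ] [Module.Finite ℤ Λ] (hnrm : ∀ x, nrm x = 0 → x = 0)
    (σ : StabilityCondition T v nrm) :
    ∃ c : ℝ, 0 < c ∧ ∀ φ E, σ.P φ E → ¬ IsZero E → c ≤ ‖σ.ch E‖ := by
  obtain ⟨C, hC, h⟩ := σ.support
  -- Adjoining `1` makes the set nonempty and takes care of the larger masses; the lattice points of
  -- charge 0 are discarded.
  have hfin : ((fun l => ‖σ.Z l‖) '' {l : Λ | nrm (1 ⊗ₜ l) ≤ C} ∩ {x | 0 < x} ∪ {1}).Finite :=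
    (((finite_setOf_norm_tmul_le nrm hnrm C).image _).inter_of_left _).union (Set.finite_singleton _)
  obtain ⟨c, hc, hmin⟩ := Set.exists_min_image _ id hfin ⟨1, by simp⟩
  refine ⟨c, ?_, fun φ E hE h0 => ?_⟩
  · rcases hc with hc | hc
    · exact hc.2
    · rw [Set.mem_singleton_iff.1 hc]; exact one_pos
  · by_cases h1 : ‖σ.ch E‖ ≤ 1
    · refine hmin _ (Or.inl ⟨⟨v (K₀.of E), ?_, rfl⟩, (ch_eq_norm_mul hE h0).1⟩)
      exact (h φ E hE h0).le.trans (mul_le_of_le_one_right hC.le h1)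
    · exact (hmin 1 (by simp)).trans (not_le.1 h1).le

/-- Stability conditions of global dimension at most `d < 1`, with the consequences of the support
property. -/
structure Thin (σ : StabilityCondition T v nrm) (d : ℝ) : Prop where
  nonneg : 0 ≤ d
  lt_one : d < 1
  bounded : σ.BoundedBy d
  finSum_stable : ∀ ⦃φ : ℝ⦄ ⦃E : T⦄, σ.P φ E → FinSum (σ.Stable φ) E
  finite_setOf_le : ∀ R : ℝ, {l : Λ | nrm (1 ⊗ₜ l) ≤ R}.Finite

theorem exists_thin [Module.Free ℤ Λ] [Module.Finite ℤ Λ] (hnrm : ∀ x, nrm x = 0 → x = 0)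
    (h : σ.gldim < 1) : ∃ d, σ.Thin d := by
  obtain ⟨d, h0, h1, hd⟩ := σ.exists_boundedBy h
  obtain ⟨c, hc, hcσ⟩ := exists_le_norm_ch hnrm σ
  exact ⟨d, h0, h1, hd, fun φ E hE => finSum_stable_of_P h1 hd hc hcσ hE,
    finite_setOf_norm_tmul_le nrm hnrm⟩

/-- `E` is a finite direct sum of stable objects with phases in `I`. -/
def Sums (σ : StabilityCondition T v nrm) (I : Set ℝ) (E : T) : Prop :=
  FinSum (fun X => ∃ φ ∈ I, σ.Stable φ X) E

theorem Stable.sums {φ : ℝ} {X : T} (h : σ.Stable φ X) {I : Set ℝ} (hI : φ ∈ I) : σ.Sums I X :=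
  .single ⟨φ, hI, h⟩

theorem Sums.mono {I J : Set ℝ} {E : T} (h : σ.Sums I E) (hI : I ⊆ J) : σ.Sums J E :=
  FinSum.mono h fun _ ⟨φ, hφ, h⟩ => ⟨φ, hI hφ, h⟩

theorem Sums.exists_comp_r {I : Set ℝ} {A E : T} (h : σ.Sums I E) (f : A ⟶ E) (hf : f ≠ 0) :
    ∃ W, ∃ φ ∈ I, σ.Stable φ W ∧ ∃ r : Retract W E, f ≫ r.r ≠ 0 := by
  obtain ⟨W, ⟨φ, h1, h2⟩, r, hr⟩ := FinSum.exists_comp_r_ne_zero h f hf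
  exact ⟨W, φ, h1, h2, r, hr⟩

theorem Sums.exists_i_comp {I : Set ℝ} {A E : T} (h : σ.Sums I E) (f : E ⟶ A) (hf : f ≠ 0) :
    ∃ W, ∃ φ ∈ I, σ.Stable φ W ∧ ∃ r : Retract W E, r.i ≫ f ≠ 0 := by
  obtain ⟨W, ⟨φ, h1, h2⟩, r, hr⟩ := FinSum.exists_i_comp_ne_zero h f hf
  exact ⟨W, φ, h1, h2, r, hr⟩

theorem Stable.id_ne_zero {φ : ℝ} {X : T} (h : σ.Stable φ X) : 𝟙 X ≠ 0 := fun h0 =>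
  h.ne_zero ((IsZero.iff_id_eq_zero X).2 h0)

namespace Thin

variable {d : ℝ} (hT : σ.Thin d)
include hT

theorem sums_univ (E : T) : σ.Sums Set.univ E := by
  refine (finSum_semistable hT.lt_one hT.bounded E).bind ?_
  rintro X ⟨⟨φ, hX⟩, -⟩
  exact (hT.finSum_stable hX).mono fun W hW => ⟨φ, trivial, hW⟩

theorem phase_le {a b : ℝ} {X Y : T} (hX : σ.Stable a X) (hY : σ.Stable b Y) (f : X ⟶ Y)
    (hf : f ≠ 0) : a ≤ b ∧ b ≤ a + d :=
  ⟨not_lt.1 fun h => hf (σ.hom_zero _ _ _ _ h hX.mem hY.mem f), hT.bounded hX.mem hY.mem f hf⟩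

theorem isIso {a : ℝ} {X Y : T} (hX : σ.Stable a X) (hY : σ.Stable a Y) (f : X ⟶ Y)
    (hf : f ≠ 0) : IsIso f := hX.isIso hT.lt_one hT.bounded hY f hf

theorem phase_eq {a b : ℝ} {X Y : T} (hX : σ.Stable a X) (hY : σ.Stable b Y) (e : X ≅ Y) :
    a = b := by
  refine le_antisymm (hT.phase_le hX hY e.hom fun h => hX.id_ne_zero ?_).1
    (hT.phase_le hY hX e.inv fun h => hX.id_ne_zero ?_).1
  · rw [← e.hom_inv_id, h, zero_comp]
  · rw [← e.hom_inv_id, h, comp_zero]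

/-- Phase bounds for an object can thus be checked on its stable retracts, by exhibiting nonzero
maps to or from objects of known phase. -/
theorem sums_of_retracts {I : Set ℝ} {E : T}
    (h : ∀ φ W, σ.Stable φ W → Retract W E → φ ∈ I) : σ.Sums I E :=
  (FinSum.with_retract (hT.sums_univ E)).mono fun W ⟨⟨φ, _, hW⟩, ⟨r⟩⟩ => ⟨φ, h φ W hW r, hW⟩

theorem exists_phases {I J : Set ℝ} {A B : T} (hA : σ.Sums I A) (hB : σ.Sums J B) (f : A ⟶ B)
    (hf : f ≠ 0) : ∃ a ∈ I, ∃ b ∈ J, a ≤ b ∧ b ≤ a + d := by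
  obtain ⟨W, a, ha, hW, r, hr⟩ := hA.exists_i_comp f hf
  obtain ⟨V, b, hb, hV, s, hs⟩ := hB.exists_comp_r _ hr
  exact ⟨a, ha, b, hb, hT.phase_le hW hV _ hs⟩

omit hT in
theorem split {I : Set ℝ} {E : T} (h : σ.Sums I E) (a : ℝ) :
    ∃ E₁ E₂, Nonempty (E ≅ E₁ ⊞ E₂) ∧ σ.Sums {φ ∈ I | a ≤ φ} E₁ ∧ σ.Sums {φ ∈ I | φ < a} E₂ := by
  refine FinSum.split h ?_
  rintro X ⟨φ, hφ, hX⟩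
  rcases le_or_gt a φ with h | h
  · exact Or.inl ⟨φ, ⟨hφ, h⟩, hX⟩
  · exact Or.inr ⟨φ, ⟨hφ, h⟩, hX⟩

/-- For a nonzero morphism to a stable object, the summands of the fiber map nontrivially to the
source. -/
theorem shift_comp_ne_zero_of_fiber {K L Y W : T} {f : K ⟶ L} {g : L ⟶ Y} {t : Y ⟶ K⟦(1 : ℤ)⟧}
    (h : Triangle.mk f g t ∈ distTriang T) {b φ : ℝ} (hY : σ.Stable b Y) (hg : g ≠ 0)
    (hW : σ.Stable φ W) (r : Retract W (K⟦(1 : ℤ)⟧)) : r.i ≫ f⟦(1 : ℤ)⟧' ≠ 0 := by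
  intro h0
  obtain ⟨s, hs⟩ := exists_retract_of_comp_eq_zero h r h0
  have := isIso_r s (hY.isIso_of_retract s hW.ne_zero)
  exact hg (by rw [← cancel_mono s.r, hs, zero_comp])

theorem comp_ne_zero_of_fiber {K L Y W : T} {f : K ⟶ L} {g : L ⟶ Y} {t : Y ⟶ K⟦(1 : ℤ)⟧}
    (h : Triangle.mk f g t ∈ distTriang T) {b φ : ℝ} (hY : σ.Stable b Y) (hg : g ≠ 0)
    (hW : σ.Stable φ W) (r : Retract W K) : r.i ≫ f ≠ 0 := fun h0 =>
  hT.shift_comp_ne_zero_of_fiber h hY hg (hW.shift 1) (r.map (shiftFunctor T (1 : ℤ))) (by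
    change (shiftFunctor T (1 : ℤ)).map r.i ≫ _ = 0
    rw [← Functor.map_comp, h0, Functor.map_zero])

end Thin

/-! ### Bounds for central charges in a sector -/

/-- Phases at distance at most `w` from `θ`. -/
def sector (θ w : ℝ) : Set ℝ := {φ | |φ - θ| ≤ w}

/-- In a sector smaller than a half-plane charges cannot cancel: the mass of each summand is at most
its `len` divided by `cos (π w)`. The support property and the triangle inequality then add up over
the summands. -/
theorem exists_nrm_le (σ : StabilityCondition T v nrm) {w : ℝ} (hw : w < 1 / 2) :
    ∃ K : ℝ, 0 < K ∧ ∀ θ E, σ.Sums (sector θ w) E →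
      nrm (1 ⊗ₜ v (K₀.of E)) ≤ K * σ.len θ E := by
  obtain ⟨C, hC, h⟩ := σ.support
  -- For `w < 0` the sector is empty and only zero objects remain; `cos (π w)` need not be positive
  -- there.
  by_cases hw0 : w < 0
  · refine ⟨1, one_pos, fun θ E hE => ?_⟩
    have hz : IsZero E := by
      cases hE with
      | zero _ h => exact h
      | add X Y _ hX _ e =>
        obtain ⟨φ, hφ, -⟩ := hX
        exact absurd ((abs_nonneg _).trans hφ) (not_le.2 hw0)
    simp [K₀.of_isZero hz, len_isZero θ hz]
  have hpi := Real.pi_pos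
  have hκ : 0 < Real.cos (Real.pi * w) :=
    Real.cos_pos_of_mem_Ioo ⟨by nlinarith, by nlinarith⟩
  refine ⟨C / Real.cos (Real.pi * w), div_pos hC hκ, fun θ E hE => ?_⟩
  induction hE with
  | zero _ h => simp [K₀.of_isZero h, len_isZero θ h]
  | add X Y E hX _ e ih =>
    obtain ⟨φ, hφ, hX⟩ := hX
    rw [len_iso θ e, len_biprod, K₀.of_iso e, K₀.of_biprod, map_add, TensorProduct.tmul_add,
      mul_add]
    refine (map_add_le_add nrm _ _).trans (add_le_add ?_ ih)
    refine (h φ X hX.mem hX.ne_zero).le.trans ?_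
    rw [len_eq hX.mem hX.ne_zero, div_mul_eq_mul_div, mul_div_assoc]
    refine mul_le_mul_of_nonneg_left ?_ hC.le
    rw [le_div_iff₀ hκ]
    refine mul_le_mul_of_nonneg_left ?_ (norm_nonneg (σ.ch X))
    rw [← Real.cos_abs (Real.pi * (φ - θ)), abs_mul, abs_of_pos hpi]
    have hφ' : |φ - θ| ≤ w := hφ
    exact Real.cos_le_cos_of_nonneg_of_le_pi (by positivity) (by nlinarith) (by nlinarith)

theorem len_nonneg_of_sums {w θ : ℝ} (hw : w < 1 / 2) {E : T} (hE : σ.Sums (sector θ w) E) :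
    0 ≤ σ.len θ E :=
  len_nonneg (FinSum.mono hE fun _ ⟨φ, hφ, hX⟩ => ⟨φ, le_trans hφ hw.le, hX.mem⟩)

theorem len_pos {w θ : ℝ} (hw : w < 1 / 2) {E : T} (hE : σ.Sums (sector θ w) E)
    (h0 : ¬ IsZero E) : 0 < σ.len θ E := by
  cases hE with
  | zero _ h => exact absurd h h0
  | add X Y E hX hY e =>
    obtain ⟨φ, hφ, hX⟩ := hX
    rw [len_iso θ e, len_biprod]
    refine add_pos_of_pos_of_nonneg ?_ (len_nonneg_of_sums hw hY)
    have hφ' : |φ - θ| ≤ w := hφ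
    rw [abs_le] at hφ'
    have hpi := Real.pi_pos
    rw [len_eq hX.mem hX.ne_zero]
    exact mul_pos (ch_eq_norm_mul hX.mem hX.ne_zero).1
      (Real.cos_pos_of_mem_Ioo ⟨by nlinarith, by nlinarith⟩)

/-! ### Finiteness of the set of stable objects receiving a morphism -/

/-- The isomorphism classes of stable objects with phase in `J` that receive a nonzero morphism
from `L`. -/
def targets (σ : StabilityCondition T v nrm) (J : Set ℝ) (L : T) :
    Set (Quotient (isIsomorphicSetoid T)) :=
  {c | ∃ Y, ∃ φ ∈ J, σ.Stable φ Y ∧ (∃ f : L ⟶ Y, f ≠ 0) ∧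
    Quotient.mk (isIsomorphicSetoid T) Y = c}

theorem Icc_subset_sector (a b : ℝ) : Set.Icc a b ⊆ sector ((a + b) / 2) ((b - a) / 2) := by
  rintro x ⟨h1, h2⟩
  change |x - (a + b) / 2| ≤ (b - a) / 2
  rw [abs_le]
  constructor <;> linarith

namespace Thin

variable {d : ℝ} (hT : σ.Thin d)
include hT

/-- `L'` is the part of the fiber of `h` with phases at least `s - d`. The remaining part is more
than `d` below `J`, so it is invisible to targets with phase in `J`. Hence a map from `L` that
vanishes on `L'` factors through `Y₀`. -/
theorem exists_smaller_of_hom [IsTriangulated T] {s δ : ℝ} {J : Set ℝ}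
    (hJ : J ⊆ Set.Icc s (s + δ)) {L Y₀ : T} (hL : σ.Sums (Set.Icc (s - d) (s + δ)) L) {b : ℝ}
    (hb : b ∈ J) (hY₀ : σ.Stable b Y₀) (h : L ⟶ Y₀) (h0 : h ≠ 0) {θ w : ℝ} (hw : w < 1 / 2)
    (hθ : Set.Icc (s - d) (s + δ) ⊆ sector θ w) :
    ∃ L', σ.Sums (Set.Icc (s - d) (s + δ)) L' ∧ σ.len θ L' < σ.len θ L ∧
      σ.targets J L ⊆ σ.targets J L' ∪ σ.targets J Y₀ := by
  obtain ⟨K, k, t, hΔ⟩ := distinguished_cocone_triangle₁ h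
  have hK : σ.Sums (Set.Iic (s + δ)) K := hT.sums_of_retracts fun φ W hW r => by
    obtain ⟨a, rfl, c, hc, hac, -⟩ := hT.exists_phases (hW.sums (Set.mem_singleton φ)) hL _
      (hT.comp_ne_zero_of_fiber hΔ hY₀ h0 hW r)
    exact hac.trans hc.2
  obtain ⟨L', N, ⟨e⟩, hL', hN⟩ := split hK (s - d)
  replace hL' : σ.Sums (Set.Icc (s - d) (s + δ)) L' := hL'.mono fun x hx => ⟨hx.2, hx.1⟩
  have hj := biprod_triangle_distinguished e
  -- The octahedron for `L' ⟶ K ⟶ L` gives a triangle `N ⟶ C ⟶ Y₀`, where `C` is the cone of `L' ⟶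
  -- L`.
  set j := biprod.inl ≫ e.inv with hjdef
  obtain ⟨C, p, u, hC⟩ := distinguished_cocone_triangle (j ≫ k)
  let o := Triangulated.someOctahedron rfl hj hΔ hC
  have hp : p ≫ o.m₃ = h := o.comm₃
  have ho := o.mem
  have hCs : σ.Sums (Set.Icc (s - d) (s + δ)) C := hT.sums_of_retracts fun φ W hW r => by
    -- Otherwise `W` would be a retract of `L'[1]`, hence of `K[1]`, killed by the map to `L[1]`.
    -- The fiber lemma excludes this.
    have h1 : p ≫ r.r ≠ 0 := by
      intro hz
      obtain ⟨a, ha⟩ := exists_eq_comp₃ hC r.r hz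
      let rL : Retract W (L'⟦(1 : ℤ)⟧) := ⟨r.i ≫ u, a, by rw [Category.assoc, ← ha, r.retract]⟩
      let rj : Retract L' K := ⟨j, e.hom ≫ biprod.fst, by simp [hjdef]⟩
      refine hT.shift_comp_ne_zero_of_fiber hΔ hY₀ h0 hW
        (rL.trans (rj.map (shiftFunctor T (1 : ℤ)))) ?_
      change ((r.i ≫ u) ≫ j⟦(1 : ℤ)⟧') ≫ k⟦(1 : ℤ)⟧' = 0
      rw [Category.assoc, ← Functor.map_comp, Category.assoc, comp_eq_zero₃₁ hC, comp_zero]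
    obtain ⟨a, ha, c, rfl, hac, -⟩ := hT.exists_phases hL (hW.sums (Set.mem_singleton φ)) _ h1
    refine ⟨ha.1.trans hac, ?_⟩
    -- Otherwise `W` would map nontrivially to `N`, whose phases lie below `s - d`, while `W` has
    -- phase at least `s - d`.
    have h2 : r.i ≫ o.m₃ ≠ 0 := by
      intro hz
      obtain ⟨x, hx⟩ := exists_lift₂ ho r.i hz
      have hx0 : x ≠ 0 := by
        rintro rfl
        apply hW.id_ne_zero
        rw [← r.retract, hx, zero_comp, zero_comp]
      obtain ⟨a', rfl, c', hc', hac', -⟩ :=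
        hT.exists_phases (hW.sums (Set.mem_singleton _)) hN x hx0
      have := ha.1
      have := hc'.2
      linarith
    exact (hT.phase_le hW hY₀ _ h2).1.trans (hJ hb).2
  have hC0 : ¬ IsZero C := fun hz => h0 (hp.symm.trans (by rw [hz.eq_of_src o.m₃ 0, comp_zero]))
  refine ⟨L', hL', ?_, ?_⟩
  · have h1 : σ.len θ L = σ.len θ L' + σ.len θ C := len_add θ hC
    have h2 := len_pos hw (hCs.mono hθ) hC0
    linarith
  · rintro c ⟨Y, φ, hφ, hY, ⟨f, hf⟩, rfl⟩
    by_cases hz : (j ≫ k) ≫ f = 0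
    · obtain ⟨y, rfl⟩ := exists_eq_comp₂ hC f hz
      have h1 : o.m₁ ≫ y = 0 := by
        by_contra hne
        obtain ⟨a, ha, c, rfl, -, hac⟩ :=
          hT.exists_phases hN (hY.sums (Set.mem_singleton φ)) _ hne
        have := (hJ hφ).1
        have := ha.2
        linarith
      obtain ⟨z, rfl⟩ := exists_eq_comp₂ ho y h1
      refine Or.inr ⟨Y, φ, hφ, hY, ⟨z, ?_⟩, rfl⟩
      rintro rfl
      exact hf (by rw [comp_zero, comp_zero])
    · exact Or.inl ⟨Y, φ, hφ, hY, ⟨_, hz⟩, rfl⟩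

/-- In a narrow sector a bound on `len` bounds the norm of the class, and `len` depends only on the
class. -/
theorem finite_setOf_len_le {θ w : ℝ} (hw : w < 1 / 2) (R : ℝ) :
    {x | x ≤ R ∧ ∃ L, σ.Sums (sector θ w) L ∧ σ.len θ L = x}.Finite := by
  obtain ⟨K, hK, h⟩ := exists_nrm_le σ hw
  refine ((hT.finite_setOf_le (K * R)).image fun l =>
    (σ.Z l * Complex.exp (-(Complex.I * Real.pi * θ))).re).subset ?_
  rintro x ⟨hx, L, hL, rfl⟩
  exact ⟨v (K₀.of L), (h θ L hL).trans (mul_le_mul_of_nonneg_left hx hK.le), rfl⟩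

/-- The values of `len` up to that of `L` form a finite set, so passing to the smaller source is a
well-founded recursion. Each step costs only the targets of one stable object, finite by `hJ0`. The
strip has width `d + δ < 1`, so it fits into an open half-plane. -/
theorem targets_finite_of_strip [IsTriangulated T] {s δ : ℝ} (hdδ : d + δ < 1) {J : Set ℝ}
    (hJ : J ⊆ Set.Icc s (s + δ))
    (hJ0 : ∀ b ∈ J, ∀ Y, σ.Stable b Y → (σ.targets J Y).Finite) {L : T}
    (hL : σ.Sums (Set.Icc (s - d) (s + δ)) L) : (σ.targets J L).Finite := by
  have hθ := Icc_subset_sector (s - d) (s + δ)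
  set θ := (s - d + (s + δ)) / 2
  have hw : (s + δ - (s - d)) / 2 < 1 / 2 := by linarith
  have hfin := hT.finite_setOf_len_le (θ := θ) hw (σ.len θ L)
  have key := hfin.wellFoundedOn (r := (· < ·)).induction (x := σ.len θ L)
    (P := fun x => ∀ L', σ.Sums (Set.Icc (s - d) (s + δ)) L' → σ.len θ L' = x →
      (σ.targets J L').Finite) ⟨le_rfl, L, hL.mono hθ, rfl⟩
  refine key ?_ L hL rfl
  rintro y ⟨hy, -⟩ ih L' hL' rfl
  by_cases hc : ∃ Y₀, ∃ b ∈ J, σ.Stable b Y₀ ∧ ∃ h : L' ⟶ Y₀, h ≠ 0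
  · obtain ⟨Y₀, b, hb, hY₀, h, h0⟩ := hc
    obtain ⟨L₁, hL₁, hlt, hsub⟩ := hT.exists_smaller_of_hom hJ hL' hb hY₀ h h0 hw hθ
    exact ((ih _ ⟨hlt.le.trans hy, L₁, hL₁.mono hθ, rfl⟩ hlt L₁ hL₁ rfl).union
      (hJ0 b hb Y₀ hY₀)).subset hsub
  · convert Set.finite_empty
    rw [Set.eq_empty_iff_forall_notMem]
    rintro c ⟨Y, φ, hφ, hY, hf, -⟩
    exact hc ⟨Y, φ, hφ, hY, hf⟩

/-- For a single phase the base case is Schur's lemma: up to isomorphism a stable object has only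
itself as target. -/
theorem targets_singleton_finite [IsTriangulated T] {p : ℝ} {L : T}
    (hL : σ.Sums (Set.Icc (p - d) p) L) : (σ.targets {p} L).Finite := by
  refine hT.targets_finite_of_strip (s := p) (δ := 0) (by linarith [hT.lt_one]) (by simp) ?_
    (by simpa using hL)
  rintro b rfl Y hY
  refine (Set.finite_singleton (Quotient.mk (isIsomorphicSetoid T) Y)).subset ?_
  rintro c ⟨Y', φ, rfl, hY', ⟨f, hf⟩, rfl⟩
  have := hT.isIso hY hY' f hf
  exact Quotient.sound ⟨(asIso f).symm⟩

/-- The fiber of `G ⟶ Y` stays in the strip, so its `len` is nonnegative and that of `Y` is at most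
that of `G`. This leaves finitely many classes. A class determines `cos (π (φ - g))`, and cosine is
injective on the range of angles concerned. -/
theorem finite_setOf_phase {g δ : ℝ} (hdδ : d + δ < 1) {G : T} (hG : σ.Stable g G) :
    {φ ∈ Set.Icc g (g + δ) | ∃ Y, σ.Stable φ Y ∧ ∃ f : G ⟶ Y, f ≠ 0}.Finite := by
  have hθ := Icc_subset_sector (g - d) (g + δ)
  set θ := (g - d + (g + δ)) / 2
  have hw : (g + δ - (g - d)) / 2 < 1 / 2 := by linarith
  obtain ⟨K, hK, h⟩ := exists_nrm_le σ hw
  have hd0 := hT.nonneg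
  refine Set.Finite.of_finite_image (f := fun φ => Real.cos (Real.pi * (φ - g)))
    (((hT.finite_setOf_le (K * σ.len θ G)).image fun l =>
      (σ.Z l * Complex.exp (-(Complex.I * Real.pi * g))).re / ‖σ.Z l‖).subset ?_) ?_
  · rintro _ ⟨φ, ⟨hφ, Y, hY, f, hf⟩, rfl⟩
    refine ⟨v (K₀.of Y), ?_, ?_⟩
    · refine (h θ Y (hY.sums (hθ ⟨by linarith [hφ.1], hφ.2⟩))).trans
        (mul_le_mul_of_nonneg_left ?_ hK.le)
      obtain ⟨N, k, t, hΔ⟩ := distinguished_cocone_triangle₁ f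
      have hN : σ.Sums (Set.Icc (g - d) (g + δ)) N := hT.sums_of_retracts fun ψ W hW r => by
        have := hT.phase_le hW hG _ (hT.comp_ne_zero_of_fiber hΔ hY hf hW r)
        exact ⟨by linarith, by linarith [hφ.1.trans hφ.2]⟩
      have h1 : σ.len θ G = σ.len θ N + σ.len θ Y := len_add θ hΔ
      have h2 := len_nonneg_of_sums hw (hN.mono hθ)
      linarith
    · have h1 := len_eq hY.mem hY.ne_zero g
      have h2 := (ch_eq_norm_mul hY.mem hY.ne_zero).1
      dsimp only
      refine (div_eq_iff (G₀ := ℝ) (b := ‖σ.Z (v (K₀.of Y))‖) h2.ne').2 ?_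
      rw [mul_comm (Real.cos _)]
      exact h1
  · have hpi := Real.pi_pos
    rintro x ⟨⟨h1, h2⟩, -⟩ y ⟨⟨h3, h4⟩, -⟩ hxy
    have := Real.injOn_cos (x₁ := Real.pi * (x - g)) (x₂ := Real.pi * (y - g))
      ⟨by nlinarith, by nlinarith⟩ ⟨by nlinarith, by nlinarith⟩ hxy
    have := mul_left_cancel₀ hpi.ne' this
    linarith

theorem targets_window_finite [IsTriangulated T] {g δ : ℝ} (hdδ : d + δ < 1) {G : T}
    (hG : σ.Stable g G) : (σ.targets (Set.Icc g (g + δ)) G).Finite := by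
  refine Set.Finite.subset ((hT.finite_setOf_phase hdδ hG).biUnion
    (t := fun φ => σ.targets {φ} G) ?_) ?_
  · rintro φ ⟨hφ, Y, hY, f, hf⟩
    exact hT.targets_singleton_finite (hG.sums ⟨by linarith [(hT.phase_le hG hY f hf).2], hφ.1⟩)
  · rintro c ⟨Y, φ, hφ, hY, hf, rfl⟩
    simp only [Set.mem_iUnion]
    exact ⟨φ, ⟨hφ, Y, hY, hf⟩, Y, φ, rfl, hY, hf, rfl⟩

/-- Only finitely many stable objects receive a nonzero morphism from a given stable object. -/
theorem targets_finite [IsTriangulated T] {g : ℝ} {G : T} (hG : σ.Stable g G) :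
    (σ.targets Set.univ G).Finite := by
  have hd0 := hT.nonneg
  have hd1 := hT.lt_one
  obtain ⟨δ, hδ, hdδ⟩ : ∃ δ, 0 < δ ∧ d + δ < 1 := ⟨(1 - d) / 2, by linarith, by linarith⟩
  have hfin : {k : ℕ | k * δ ≤ d}.Finite := by
    refine (Set.finite_Iic ⌊d / δ⌋₊).subset fun k hk => ?_
    exact Nat.le_floor ((le_div_iff₀ hδ).2 hk)
  -- The targets of `G` have phases in `[g, g + d]`, covered by finitely many windows of length `δ`.
  -- In each window `s = g + kδ` with `kδ ≤ d`, so `g` lies in the strip `[s - d, s + δ]`.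
  refine (hfin.biUnion (t := fun k => σ.targets (Set.Icc (g + k * δ) (g + k * δ + δ)) G)
    ?_).subset ?_
  · intro k hk
    refine hT.targets_finite_of_strip hdδ subset_rfl (fun b hb Y hY => ?_) (hG.sums ?_)
    · refine (hT.targets_window_finite hdδ hY).subset ?_
      rintro c ⟨Y', φ, hφ, hY', ⟨f, hf⟩, rfl⟩
      exact ⟨Y', φ, ⟨(hT.phase_le hY hY' f hf).1, hφ.2.trans (by linarith [hb.1])⟩, hY',
        ⟨f, hf⟩, rfl⟩
    · have : (k : ℝ) * δ ≤ d := hk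
      have : 0 ≤ (k : ℝ) * δ := by positivity
      constructor <;> linarith
  · rintro c ⟨Y, φ, -, hY, ⟨f, hf⟩, rfl⟩
    obtain ⟨h1, h2⟩ := hT.phase_le hG hY f hf
    have h3 := Nat.floor_le (div_nonneg (sub_nonneg.2 h1) hδ.le)
    have h4 := Nat.lt_floor_add_one ((φ - g) / δ)
    rw [le_div_iff₀ hδ] at h3
    rw [div_lt_iff₀ hδ] at h4
    simp only [Set.mem_iUnion]
    exact ⟨⌊(φ - g) / δ⌋₊, by change _ * δ ≤ d; linarith, Y, φ, ⟨by linarith, by linarith⟩, hY,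
      ⟨f, hf⟩, rfl⟩

end Thin

/-! ### Injective objects of the heart -/

/-- Stable objects of the heart `P((0, 1])` that are injective in it. -/
structure Inj (σ : StabilityCondition T v nrm) (φ : ℝ) (I : T) : Prop where
  stable : σ.Stable φ I
  mem : φ ∈ Set.Ioc (0 : ℝ) 1
  eq_zero : ∀ ψ ∈ Set.Ioc (0 : ℝ) 1, ∀ F, σ.Stable ψ F → ∀ f : F ⟶ I⟦(1 : ℤ)⟧, f = 0

/-- The phase of an isomorphism class of stable objects. -/
def phase (σ : StabilityCondition T v nrm) (c : Quotient (isIsomorphicSetoid T)) : ℝ :=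
  open Classical in if h : ∃ φ Y, σ.Stable φ Y ∧ Quotient.mk (isIsomorphicSetoid T) Y = c then
    h.choose else 0

theorem shift_map_ne_zero {X Y : T} {f : X ⟶ Y} (hf : f ≠ 0) (n : ℤ) : f⟦n⟧' ≠ 0 := fun h =>
  hf ((shiftFunctor T n).map_injective (by rw [h, Functor.map_zero]))

namespace Thin

variable {d : ℝ} (hT : σ.Thin d)
include hT

theorem phase_mk {φ : ℝ} {Y : T} (hY : σ.Stable φ Y) :
    σ.phase (Quotient.mk (isIsomorphicSetoid T) Y) = φ := by
  have h : ∃ φ Y', σ.Stable φ Y' ∧ Quotient.mk (isIsomorphicSetoid T) Y' =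
      Quotient.mk (isIsomorphicSetoid T) Y := ⟨φ, Y, hY, rfl⟩
  rw [phase, dif_pos h]
  obtain ⟨Y', hY', he⟩ := h.choose_spec
  obtain ⟨e⟩ := Quotient.exact he
  exact hT.phase_eq hY' hY e

/-- Every stable object of the heart maps nontrivially to an injective one. -/
theorem exists_inj [IsTriangulated T] {a : ℝ} (ha : a ∈ Set.Ioc (0 : ℝ) 1) {X : T}
    (hX : σ.Stable a X) : ∃ I φ, σ.Inj φ I ∧ ∃ f : X ⟶ I, f ≠ 0 := by
  have hfin : (σ.targets (Set.Ioc 0 1) X).Finite := (hT.targets_finite hX).subset (by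
    rintro c ⟨Y, φ, -, h⟩
    exact ⟨Y, φ, trivial, h⟩)
  -- A target of maximal phase; the identity of `X` shows that there is some target.
  obtain ⟨_, ⟨Y, φ, hφ, hY, ⟨f, hf⟩, rfl⟩, hmax⟩ := Set.exists_max_image _ σ.phase hfin
    ⟨_, X, a, ha, hX, ⟨𝟙 X, hX.id_ne_zero⟩, rfl⟩
  refine ⟨Y, φ, ⟨hY, hφ, fun ψ hψ F hF g => ?_⟩, f, hf⟩
  by_contra hg
  obtain ⟨E, p, q, hΔ⟩ := distinguished_cocone_triangle₂ g
  -- Otherwise `f[1]` would factor through `F`, but `X[1]` has phase above 1 and `F` has phase at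
  -- most 1.
  have hfp : f ≫ p ≠ 0 := by
    intro h0
    obtain ⟨u, hu⟩ := exists_lift₁ hΔ (f⟦(1 : ℤ)⟧') (by
      rw [← Functor.map_comp, h0, Functor.map_zero])
    refine shift_map_ne_zero hf 1 ?_
    rw [hu, σ.hom_zero _ _ _ _ (by push_cast; linarith [ha.1, hψ.2]) (hX.shift 1).mem hF.mem u,
      zero_comp]
  obtain ⟨W, φ', -, hW, r, hr⟩ := (hT.sums_univ E).exists_comp_r _ hfp
  rw [Category.assoc] at hr
  have hpr : p ≫ r.r ≠ 0 := by
    intro h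
    rw [h, comp_zero] at hr
    exact hr rfl
  have h1 := (hT.phase_le hY hW _ hpr).1
  have h2 : φ' ≤ 1 := by
    by_contra hlt
    rw [not_le] at hlt
    obtain ⟨u, hu⟩ := exists_lift₂ hΔ r.i
      (σ.hom_zero _ _ _ _ (hψ.2.trans_lt hlt) hW.mem hF.mem _)
    apply hW.id_ne_zero
    rw [← r.retract, hu, σ.hom_zero _ _ _ _ (hφ.2.trans_lt hlt) hW.mem hY.mem u, zero_comp,
      zero_comp]
  have h3 := hmax _ ⟨W, φ', ⟨hφ.1.trans_le h1, h2⟩, hW, ⟨_, hr⟩, rfl⟩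
  rw [hT.phase_mk hW, hT.phase_mk hY] at h3
  -- By maximality `W` has the phase of `Y`, so `Y ⟶ W` is invertible. Hence `p` is a split
  -- monomorphism and the extension class `g` is zero.
  obtain rfl := le_antisymm h1 h3
  have := hT.isIso hY hW _ hpr
  exact hg (Triangle.mor₃_eq_zero_of_mono₁ _ hΔ (mono_of_mono p r.r))

/-- The phase bound gives `-1 < k < 2`, and `k = 1` is the case excluded by injectivity. -/
theorem Inj.hom_shift {φ a : ℝ} {I X : T} (hI : σ.Inj φ I) (ha : a ∈ Set.Ioc (0 : ℝ) 1)
    (hX : σ.Stable a X) {k : ℤ} (hk : k ≠ 0) (f : X ⟶ I⟦k⟧) : f = 0 := by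
  by_contra hf
  obtain ⟨h1, h2⟩ := hT.phase_le hX (hI.stable.shift k) f hf
  have hd := hT.lt_one
  have h3 : (-1 : ℝ) < k := by linarith [ha.1, hI.mem.2]
  have h4 : (k : ℝ) < 2 := by linarith [ha.2, hI.mem.1]
  have h5 : -1 < k := by exact_mod_cast h3
  have h6 : k < 2 := by exact_mod_cast h4
  obtain rfl : k = 1 := by omega
  exact hf (hI.eq_zero a ha X hX f)

/-- Only finitely many injective stable objects receive a nonzero morphism from some shift of a
given object. -/
theorem finite_inj_of_hom [IsTriangulated T] (G : T) :
    {c | ∃ I φ, σ.Inj φ I ∧ (∃ k : ℤ, ∃ f : G⟦k⟧ ⟶ I, f ≠ 0) ∧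
      Quotient.mk (isIsomorphicSetoid T) I = c}.Finite := by
  have hG := hT.sums_univ G
  induction hG with
  | zero E h =>
    convert Set.finite_empty
    rw [Set.eq_empty_iff_forall_notMem]
    rintro c ⟨I, φ, -, ⟨k, f, hf⟩, -⟩
    refine hf (IsZero.eq_of_src ?_ _ _)
    rw [IsZero.iff_id_eq_zero, ← CategoryTheory.Functor.map_id, h.eq_of_src (𝟙 E) 0,
      Functor.map_zero]
  | add X Y E hX _ e ih =>
    obtain ⟨a, -, hX⟩ := hX
    -- Only the shift by `1 - ⌈a⌉`, which moves the phase `a` into `(0, 1]`, can map nontrivially to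
    -- an injective.
    refine ((hT.targets_finite (hX.shift (1 - ⌈a⌉))).union ih).subset ?_
    rintro c ⟨I, φ, hI, ⟨k, f, hf⟩, rfl⟩
    have := preservesBinaryBiproduct_of_preservesBiproduct (shiftFunctor T k) X Y
    let e' : E⟦k⟧ ≅ X⟦k⟧ ⊞ Y⟦k⟧ :=
      (shiftFunctor T k).mapIso e ≪≫ (shiftFunctor T k).mapBiprod X Y
    by_cases h1 : biprod.inl ≫ e'.inv ≫ f = 0
    · refine Or.inr ⟨I, φ, hI, ⟨k, biprod.inr ≫ e'.inv ≫ f, fun h2 => hf ?_⟩, rfl⟩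
      rw [← cancel_epi e'.inv, comp_zero]
      ext <;> simp [h1, h2]
    · refine Or.inl ⟨I, φ, trivial, hI.stable, ?_, rfl⟩
      obtain ⟨h2, h3⟩ := hT.phase_le (hX.shift k) hI.stable _ h1
      have hd := hT.lt_one
      -- If `a + k ≤ 0`, then `X[k + 1]` lies in the heart and its map to `I[1]` vanishes by
      -- injectivity.
      have h4 : 0 < a + k := by
        by_contra hlt
        rw [not_lt] at hlt
        refine shift_map_ne_zero h1 1 (hI.eq_zero (a + k + 1) ⟨?_, by linarith⟩ _ ?_ _)
        · linarith [hI.mem.1]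
        · simpa using (hX.shift k).shift 1
      obtain rfl : k = 1 - ⌈a⌉ := by
        have : ⌈a⌉ = 1 - k := Int.ceil_eq_iff.2 ⟨by push_cast; linarith, by
          push_cast; linarith [hI.mem.2]⟩
        omega
      exact ⟨_, h1⟩

/-- The injective stable objects of the heart, ordered by phase. -/
theorem exists_inj_family [IsTriangulated T] {G : T}
    (hG : ∀ X : T, (∀ (k : ℤ) (f : G⟦k⟧ ⟶ X), f = 0) → IsZero X) :
    ∃ (n : ℕ) (E : Fin n → T) (φ : Fin n → ℝ), Monotone φ ∧ (∀ i, σ.Inj (φ i) (E i)) ∧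
      (∀ i j, Nonempty (E i ≅ E j) → i = j) ∧
      ∀ I ψ, σ.Inj ψ I → ∃ i, Nonempty (I ≅ E i) := by
  have hfin := hT.finite_inj_of_hom G
  set S := {c | ∃ I φ, σ.Inj φ I ∧ (∃ k : ℤ, ∃ f : G⟦k⟧ ⟶ I, f ≠ 0) ∧
      Quotient.mk (isIsomorphicSetoid T) I = c} with hS
  have := hfin.fintype
  let c₀ := (Fintype.equivFin S).symm
  let τ := Tuple.sort fun i => σ.phase (c₀ i)
  have hmem : ∀ i, ∃ I φ, σ.Inj φ I ∧ Quotient.mk (isIsomorphicSetoid T) I = c₀ (τ i) := fun i => by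
    obtain ⟨I, φ, h, -, h'⟩ := (c₀ (τ i)).2
    exact ⟨I, φ, h, h'⟩
  choose E φ hE hc using hmem
  refine ⟨_, E, φ, fun i j hij => ?_, hE, fun i j ⟨e⟩ => ?_, fun I ψ hI => ?_⟩
  · have := Tuple.monotone_sort (fun i => σ.phase (c₀ i)) hij
    simp only [Function.comp_apply] at this
    rw [← hT.phase_mk (hE i).stable, ← hT.phase_mk (hE j).stable, hc, hc]
    exact this
  · have : (c₀ (τ i)).1 = (c₀ (τ j)).1 := by
      rw [← hc, ← hc]; exact Quotient.sound ⟨e⟩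
    exact τ.injective (c₀.injective (Subtype.ext this))
  · have hIS : Quotient.mk (isIsomorphicSetoid T) I ∈ S := by
      refine ⟨I, ψ, hI, ?_, rfl⟩
      by_contra hne
      push Not at hne
      exact hI.stable.ne_zero (hG I hne)
    refine ⟨τ.symm (c₀.symm ⟨_, hIS⟩), ?_⟩
    apply Quotient.exact (s := isIsomorphicSetoid T)
    rw [hc]; simp

end Thin

end StabilityCondition
-- ### Left approximations by finite direct sums
/-- Finitely many morphisms from `X` factor through a single one, to the sum of their targets. -/
theorem exists_common_factor {X : T} {Q : T → Prop} (l : List (Σ Y : T, X ⟶ Y))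
    (hl : ∀ p ∈ l, Q p.1) :
    ∃ (M : T) (m : X ⟶ M), FinSum Q M ∧ ∀ p ∈ l, ∃ u : M ⟶ p.1, m ≫ u = p.2 := by
  induction l with
  | nil => exact ⟨0, 0, .zero _ (isZero_zero T), by simp⟩
  | cons p l ih =>
    obtain ⟨M, m, hM, h⟩ := ih fun q hq => hl q (List.mem_cons_of_mem _ hq)
    refine ⟨p.1 ⊞ M, biprod.lift p.2 m, .add _ _ _ (hl p List.mem_cons_self) hM (Iso.refl _), ?_⟩
    intro q hq
    rcases List.mem_cons.1 hq with rfl | hq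
    · exact ⟨biprod.fst, by simp⟩
    · obtain ⟨u, hu⟩ := h q hq
      exact ⟨biprod.snd ≫ u, by simp [hu]⟩

/-- Take the product of generators of the finitely many Hom spaces. The maps that factor through it
form a subspace containing the generators. -/
theorem exists_approximation [Linear ℂ T] (hfd : ∀ X Y : T, FiniteDimensional ℂ (X ⟶ Y)) {n : ℕ}
    (E : Fin n → T) (X : T) : ∃ (M : T) (m : X ⟶ M), FinSum (fun W => ∃ i, W = E i) M ∧
      ∀ i (f : X ⟶ E i), ∃ u : M ⟶ E i, m ≫ u = f := by
  have hs : ∀ i, ∃ s : Finset (X ⟶ E i), Submodule.span ℂ (s : Set (X ⟶ E i)) = ⊤ := fun i =>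
    (hfd X (E i)).fg_top
  choose s hs using hs
  obtain ⟨M, m, hM, h⟩ := exists_common_factor (X := X) (Q := fun W => ∃ i, W = E i)
    ((List.finRange n).flatMap fun i => (s i).toList.map fun f => ⟨E i, f⟩) (by
      intro p hp
      simp only [List.mem_flatMap, List.mem_map] at hp
      obtain ⟨i, -, f, -, rfl⟩ := hp
      exact ⟨i, rfl⟩)
  refine ⟨M, m, hM, fun i f => ?_⟩
  have hle : Submodule.span ℂ (s i : Set (X ⟶ E i)) ≤
      LinearMap.range (Linear.leftComp ℂ (E i) m) := by
    rw [Submodule.span_le]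
    intro f hf
    refine h ⟨E i, f⟩ ?_
    simp only [List.mem_flatMap, List.mem_map]
    exact ⟨i, List.mem_finRange i, f, Finset.mem_toList.2 hf, rfl⟩
  rw [hs] at hle
  exact hle (Submodule.mem_top (x := f))

/-! ### ### The injectives form a full strong exceptional collection -/

namespace StabilityCondition

variable {Λ : Type*} [AddCommGroup Λ] {v : K₀ T →+ Λ} {nrm : Seminorm ℝ (ℝ ⊗[ℤ] Λ)}
  {σ : StabilityCondition T v nrm}

namespace Thin

variable {d : ℝ} (hT : σ.Thin d)
include hT

/-- For `X` stable in the heart, the triangle `X ⟶ M ⟶ C` of a left approximation by the `E i` is an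
injective resolution of length one. Other stable objects are shifts of these. -/
theorem mem_of_inj_mem [IsTriangulated T] [Linear ℂ T]
    (hfd : ∀ X Y : T, FiniteDimensional ℂ (X ⟶ Y)) {n : ℕ} {E : Fin n → T} {φ : Fin n → ℝ}
    (hE : ∀ i, σ.Inj (φ i) (E i)) (hI : ∀ I ψ, σ.Inj ψ I → ∃ i, Nonempty (I ≅ E i))
    (P : ObjectProperty T) [P.IsTriangulated] [P.IsClosedUnderIsomorphisms]
    (hP : ∀ i, P (E i)) (X : T) : P X := by
  have hzero : ∀ X, IsZero X → P X := fun X hX => P.prop_of_isZero hX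
  have hiso : ∀ X Y : T, (X ≅ Y) → P Y → P X := fun X Y e h => P.prop_of_iso e.symm h
  have hadd : ∀ X Y, P X → P Y → P (X ⊞ Y) := fun X Y hX hY =>
    P.ext_of_isTriangulatedClosed₂ _ (binaryBiproductTriangle_distinguished X Y) hX hY
  have heart : ∀ (a : ℝ) (X : T), a ∈ Set.Ioc (0 : ℝ) 1 → σ.Stable a X → P X := by
    intro a X ha hX
    have hd := hT.lt_one
    obtain ⟨M, m, hM, hm⟩ := exists_approximation hfd E X
    obtain ⟨C, q, t, hΔ⟩ := distinguished_cocone_triangle m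
    have hC : FinSum (fun W => ∃ ψ, σ.Inj ψ W) C := by
      refine (FinSum.with_retract (hT.sums_univ C)).mono ?_
      rintro W ⟨⟨ψ, -, hW⟩, ⟨r⟩⟩
      have hψ : ψ ∈ Set.Ioc (0 : ℝ) 1 := by
        -- `k` is the integer for which `W[-k]` lies in the heart. Mapping `W[-k]` to an injective
        -- gives a nonzero `y : C ⟶ (E i)[k]`.
        set k := ⌈ψ⌉ - 1 with hk
        have hk1 : (k : ℝ) < ψ := by
          have := Int.ceil_lt_add_one ψ
          push_cast [hk]; linarith
        have hk2 : ψ ≤ k + 1 := by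
          have := Int.le_ceil ψ
          push_cast [hk]; linarith
        have hmem : ψ + ((-k : ℤ) : ℝ) ∈ Set.Ioc (0 : ℝ) 1 :=
          ⟨by push_cast; linarith, by push_cast; linarith⟩
        obtain ⟨I, χ, hIinj, f, hf⟩ := hT.exists_inj hmem (hW.shift (-k))
        obtain ⟨i, ⟨eI⟩⟩ := hI I χ hIinj
        let e : (W⟦-k⟧)⟦k⟧ ≅ W := (shiftFunctorCompIsoId T (-k) k (by simp)).app W
        have hy : r.r ≫ e.inv ≫ (f ≫ eI.hom)⟦k⟧' ≠ 0 := by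
          intro h0
          have h1 : e.inv ≫ (f ≫ eI.hom)⟦k⟧' = 0 := by
            rw [← cancel_epi r.r, h0, comp_zero]
          rw [Preadditive.IsIso.comp_left_eq_zero] at h1
          refine shift_map_ne_zero (f := f ≫ eI.hom) (fun h2 => hf ?_) k h1
          rwa [Preadditive.IsIso.comp_right_eq_zero] at h2
        set y : C ⟶ (E i)⟦k⟧ := r.r ≫ e.inv ≫ (f ≫ eI.hom)⟦k⟧' with hydef
        -- For `k ≠ 0` the map `y` vanishes on `M`, so it comes from a map `x : X ⟶ (E i)[k - 1]`.
        -- This is zero unless `k = 1`; in that case it extends along `m`, and then `y` is zero.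
        have hk0 : k = 0 := by
          by_contra hk0
          have hqy : q ≫ y = 0 := by
            by_contra hne
            obtain ⟨V, ⟨j, rfl⟩, s, hs⟩ := hM.exists_i_comp_ne_zero _ hne
            exact hs (Inj.hom_shift hT (hE i) (hE j).mem (hE j).stable hk0 _)
          obtain ⟨z, hz⟩ := exists_eq_comp₃ hΔ y hqy
          have hz0 : z ≠ 0 := by
            rintro rfl
            exact hy (by rw [hz, comp_zero])
          let e₁ : ((E i)⟦k - 1⟧)⟦(1 : ℤ)⟧ ≅ (E i)⟦k⟧ :=
            ((shiftFunctorAdd' T (k - 1) 1 k (by ring)).app (E i)).symm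
          obtain ⟨x, hx⟩ := (shiftFunctor T (1 : ℤ)).map_surjective (z ≫ e₁.inv)
          have hx0 : x ≠ 0 := by
            rintro rfl
            rw [Functor.map_zero] at hx
            exact hz0 (by rw [← cancel_mono e₁.inv, ← hx, zero_comp])
          by_cases hk1 : k = 1
          · have hk1' : k - 1 = 0 := by omega
            let e₀ : (E i)⟦k - 1⟧ ≅ E i := eqToIso (by rw [hk1']) ≪≫ (shiftFunctorZero T ℤ).app (E i)
            obtain ⟨u, hu⟩ := hm i (x ≫ e₀.hom)
            have hxm : x = m ≫ u ≫ e₀.inv := by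
              rw [← Category.assoc, hu, Category.assoc, Iso.hom_inv_id, Category.comp_id]
            apply hy
            have h3 : z = m⟦(1 : ℤ)⟧' ≫ (u ≫ e₀.inv)⟦(1 : ℤ)⟧' ≫ e₁.hom := by
              rw [← Category.assoc, ← Functor.map_comp, ← hxm, hx, Category.assoc, Iso.inv_hom_id,
                Category.comp_id]
            rw [hz, h3, ← Category.assoc, comp_eq_zero₃₁ hΔ, zero_comp]
          · exact hx0 (Inj.hom_shift hT (hE i) ha hX (by omega) x)
        rw [hk0] at hmem
        simpa using hmem
      refine ⟨ψ, hW, hψ, fun χ hχ F hF f => ?_⟩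
      by_contra hf
      have hf1 : f ≫ r.i⟦(1 : ℤ)⟧' ≠ 0 := by
        intro h0
        apply hf
        have : f ≫ r.i⟦(1 : ℤ)⟧' ≫ r.r⟦(1 : ℤ)⟧' = 0 := by rw [← Category.assoc, h0, zero_comp]
        rwa [← Functor.map_comp, r.retract, CategoryTheory.Functor.map_id, Category.comp_id] at this
      -- An object of the heart has no map to `X[2]`, so the map `F ⟶ C[1]` lifts to `M[1]`, where
      -- injectivity of the `E j` kills it.
      obtain ⟨u, hu⟩ := exists_lift₁ (rot_of_distTriang _ (rot_of_distTriang _ hΔ))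
        (f ≫ r.i⟦(1 : ℤ)⟧') (by
          by_contra hne
          have := (hT.phase_le hF ((hX.shift 1).shift 1) _ hne).2
          push_cast at this
          linarith [hχ.2, ha.1])
      have hu0 : u ≠ 0 := by
        rintro rfl
        exact hf1 (hu.trans zero_comp)
      obtain ⟨V, ⟨_, ⟨j, rfl⟩, ⟨e⟩⟩, s, hs⟩ := (hM.shift 1).exists_comp_r_ne_zero u hu0
      apply hs
      rw [← cancel_mono e.hom, zero_comp]
      exact (hE j).eq_zero χ hχ F hF _
    have hMP : P M := (hM.mono fun W ⟨i, hi⟩ => hi ▸ hP i : FinSum P M).closed hzero hiso hadd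
    have hCP : P C := (hC.mono fun W ⟨ψ, hW⟩ => by
      obtain ⟨i, ⟨e⟩⟩ := hI W ψ hW
      exact hiso _ _ e (hP i) : FinSum P C).closed hzero hiso hadd
    exact P.ext_of_isTriangulatedClosed₁ _ hΔ hMP hCP
  refine (FinSum.mono (hT.sums_univ X) ?_ : FinSum P X).closed hzero hiso hadd
  rintro W ⟨ψ, -, hW⟩
  have h1 : P (W⟦1 - ⌈ψ⌉⟧) := heart _ _ ⟨by
    have := Int.ceil_lt_add_one ψ
    push_cast; linarith, by
    have := Int.le_ceil ψ
    push_cast; linarith⟩ (hW.shift _)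
  have h2 := P.le_shift (-(1 - ⌈ψ⌉)) _ h1
  exact hiso _ _ ((shiftFunctorCompIsoId T (1 - ⌈ψ⌉) (-(1 - ⌈ψ⌉)) (by simp)).app W).symm h2

/-- In degree 0, a nonzero map from a later member to an earlier one forces equal phases. It is then
an isomorphism, and the members are pairwise nonisomorphic. -/
theorem exists_full_strong_exceptional_collection [IsTriangulated T] [Linear ℂ T]
    (hfd : ∀ X Y : T, FiniteDimensional ℂ (X ⟶ Y)) {G : T}
    (hG : ∀ X : T, (∀ (k : ℤ) (f : G⟦k⟧ ⟶ X), f = 0) → IsZero X) :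
    ∃ (n : ℕ) (E : Fin n → T), IsExceptionalCollection E ∧ IsStrong E ∧ IsFull E := by
  obtain ⟨n, E, φ, hφ, hE, hinj, hI⟩ := hT.exists_inj_family hG
  have hstrong : IsStrong E := fun i j k hk f =>
    Inj.hom_shift hT (hE j) (hE i).mem (hE i).stable hk f
  refine ⟨n, E, ⟨fun i => ⟨?_, hstrong i i⟩, fun i j hij k f => ?_⟩, hstrong,
    fun P _ _ hP X => hT.mem_of_inj_mem hfd hE hI P hP X⟩
  · have := hfd (E i) (E i)
    refine finrank_endomorphism_eq_one ℂ fun f => ⟨?_, fun hf =>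
      hT.isIso (hE i).stable (hE i).stable f hf⟩
    rintro h rfl
    apply (hE i).stable.id_ne_zero
    rw [← IsIso.hom_inv_id (0 : E i ⟶ E i), zero_comp]
  · by_cases hk : k = 0
    · subst hk
      by_contra hf
      have hf' : f ≫ (shiftFunctorZero T ℤ).hom.app (E i) ≠ 0 := by
        rwa [ne_eq, Preadditive.IsIso.comp_right_eq_zero]
      have h1 := (hT.phase_le (hE j).stable (hE i).stable _ hf').1
      have h2 := le_antisymm h1 (hφ hij.le)
      have := hT.isIso (h2 ▸ (hE j).stable) (hE i).stable _ hf'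
      exact hij.ne' (hinj _ _ ⟨asIso (f ≫ (shiftFunctorZero T ℤ).hom.app (E i))⟩)
    · exact hstrong j i k hk f

end Thin

end StabilityCondition
end Triangulated

/-! ### ### Linear algebra and the cohomology of a proper dg algebra -/

section Linear

variable {V W : Type*} [AddCommGroup V] [Module ℂ V] [AddCommGroup W] [Module ℂ W]

theorem exists_add_of_iSup_eq_top {V' : ℤ → Submodule ℂ V} (h : ⨆ i, V' i = ⊤) (i : ℤ) (x : V) :
    ∃ v ∈ V' i, ∃ w ∈ ⨆ (j) (_ : j ≠ i), V' j, v + w = x := by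
  rw [iSup_split_single V' i] at h
  exact Submodule.mem_sup.1 (h ▸ Submodule.mem_top)

/-- A submodule with finite-dimensional image is, up to a finite-dimensional submodule, contained
in the kernel. -/
theorem exists_le_sup_ker (f : V →ₗ[ℂ] W) (D : Submodule ℂ V) {U : Submodule ℂ W}
    [FiniteDimensional ℂ U] (h : D.map f ≤ U) :
    ∃ D₀ ≤ D, FiniteDimensional ℂ D₀ ∧ D ≤ D₀ ⊔ D ⊓ LinearMap.ker f := by
  let g := f.domRestrict D
  have hg : LinearMap.range g ≤ U := by
    rintro _ ⟨x, rfl⟩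
    exact h ⟨x, x.2, rfl⟩
  have : FiniteDimensional ℂ (LinearMap.range g) := Submodule.finiteDimensional_of_le hg
  obtain ⟨s, hs⟩ := g.rangeRestrict.exists_rightInverse_of_surjective
    (LinearMap.range_rangeRestrict g)
  refine ⟨LinearMap.range (D.subtype ∘ₗ s), ?_, inferInstance, fun x hx => ?_⟩
  · rintro _ ⟨y, rfl⟩
    exact (s y).2
  · refine Submodule.mem_sup.2 ⟨s (g.rangeRestrict ⟨x, hx⟩), ⟨_, rfl⟩,
      x - s (g.rangeRestrict ⟨x, hx⟩), ⟨sub_mem hx (s _).2, ?_⟩, by abel⟩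
    have := congrArg Subtype.val (LinearMap.congr_fun hs (g.rangeRestrict ⟨x, hx⟩))
    change f (s (g.rangeRestrict ⟨x, hx⟩)) = f x at this
    change f _ = 0
    rw [map_sub, this, sub_self]

end Linear

theorem DGAlgebra.d_one (A : DGAlgebra.{u}) : A.d 1 = 0 := by
  have := A.leibniz 1 A.one_mem
  simpa using this

theorem DGAlgebra.IsProper.exists_ker_le {A : DGAlgebra.{u}} (h : A.IsProper) :
    ∃ U : Submodule ℂ A.carrier, FiniteDimensional ℂ U ∧
      LinearMap.ker A.d ≤ U ⊔ LinearMap.range A.d := by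
  have : FiniteDimensional ℂ A.Cohomology := h
  let p := ((LinearMap.range A.d).comap (LinearMap.ker A.d).subtype).mkQ
  obtain ⟨s, hs⟩ := p.exists_rightInverse_of_surjective (Submodule.range_mkQ _)
  refine ⟨LinearMap.range ((LinearMap.ker A.d).subtype ∘ₗ s), inferInstance, fun x hx => ?_⟩
  refine Submodule.mem_sup.2 ⟨s (p ⟨x, hx⟩), ⟨_, rfl⟩, x - s (p ⟨x, hx⟩), ?_, by abel⟩
  have h1 : p (s (p ⟨x, hx⟩)) = p ⟨x, hx⟩ := LinearMap.congr_fun hs _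
  exact (Submodule.Quotient.eq ((LinearMap.range A.d).comap (LinearMap.ker A.d).subtype)).1 h1.symm

/-! ### ### Gradings and null-homotopic maps of dg modules -/

namespace DGMod

variable {A : DGAlgebra.{u}}

theorem iSupIndep_gr (M : DGMod A) : iSupIndep M.gr :=
  ((DirectSum.isInternal_submodule_iff_iSupIndep_and_iSup_eq_top _).1 M.isInternal).1

theorem iSup_gr (M : DGMod A) : ⨆ i, M.gr i = ⊤ :=
  ((DirectSum.isInternal_submodule_iff_iSupIndep_and_iSup_eq_top _).1 M.isInternal).2

theorem linearMap_ext (M : DGMod A) {V : Type*} [AddCommGroup V] [Module ℂ V]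
    {f g : M.carrier →ₗ[ℂ] V} (h : ∀ i, ∀ m ∈ M.gr i, f m = g m) : f = g := by
  have : ⊤ ≤ LinearMap.eqLocus f g := M.iSup_gr ▸ iSup_le fun i m hm => h i m hm
  exact LinearMap.ext fun m => this Submodule.mem_top

theorem gr_eq_of_le (M : DGMod A) {V : ℤ → Submodule ℂ M.carrier} (hV : ∀ i, V i ≤ M.gr i)
    (h : ⨆ i, V i = ⊤) (i : ℤ) : M.gr i ≤ V i := by
  intro x hx
  obtain ⟨v, hv, w, hw, rfl⟩ := exists_add_of_iSup_eq_top h i x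
  have hw' : w ∈ M.gr i := by simpa using sub_mem hx (hV i hv)
  have := (Submodule.disjoint_def.1 (M.iSupIndep_gr i)) w hw'
    ((iSup₂_mono fun j _ => hV j) hw)
  rwa [this, add_zero]

/-- The differential is homogeneous, so the component of degree `i - 1` of any primitive is already
a primitive. -/
theorem exists_homogeneous_primitive (M : DGMod A) {i : ℤ} {m : M.carrier} (hm : m ∈ M.gr i)
    (h : m ∈ LinearMap.range M.d) : ∃ y ∈ M.gr (i - 1), M.d y = m := by
  obtain ⟨y, rfl⟩ := h
  obtain ⟨v, hv, w, hw, rfl⟩ := exists_add_of_iSup_eq_top M.iSup_gr (i - 1) y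
  have hdv : M.d v ∈ M.gr i := by simpa using M.d_mem hv
  have hdw : M.d w ∈ ⨆ (j) (_ : j ≠ i), M.gr j := by
    have : (⨆ (j) (_ : j ≠ i - 1), M.gr j) ≤ (⨆ (j) (_ : j ≠ i), M.gr j).comap M.d :=
      iSup₂_le fun j hj x hx => (le_iSup₂ (f := fun j (_ : j ≠ i) => M.gr j) (j + 1)
        (by omega)) (M.d_mem hx)
    exact this hw
  have hw' : M.d w ∈ M.gr i := by simpa using sub_mem hm hdv
  have := (Submodule.disjoint_def.1 (M.iSupIndep_gr i)) _ hw' hdw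
  exact ⟨v, hv, by rw [map_add, this, add_zero]⟩

/-- The null-homotopic maps. -/
def nullHomotopic (M N : DGMod A) : Submodule ℂ (M.carrier →ₗ[ℂ] N.carrier) :=
  (homDeg M N (-1)).map (LinearMap.compRight ℂ N.d + LinearMap.lcomp ℂ N.carrier M.d)

theorem mem_nullHomotopic {M N : DGMod A} {f : M.carrier →ₗ[ℂ] N.carrier} :
    f ∈ nullHomotopic M N ↔ ∃ h ∈ homDeg M N (-1), ∀ m, N.d (h m) + h (M.d m) = f m := by
  refine ⟨?_, ?_⟩
  · rintro ⟨h, hh, rfl⟩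
    exact ⟨h, hh, fun m => rfl⟩
  · rintro ⟨h, hh, e⟩
    exact ⟨h, hh, LinearMap.ext e⟩

theorem nullHomotopic_le_homs (M N : DGMod A) : nullHomotopic M N ≤ homs M N := by
  intro f hf
  obtain ⟨h, hh, e⟩ := mem_nullHomotopic.1 hf
  refine ⟨⟨fun i m hm => ?_, fun a => ?_⟩, fun m => ?_⟩
  · rw [← e]
    have h1 := N.d_mem (hh.1 i m hm)
    have h2 := hh.1 _ _ (M.d_mem hm)
    rw [neg_add_cancel_right] at h1
    rw [add_neg_cancel_right] at h2
    rw [add_zero]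
    exact add_mem h1 h2
  · refine LinearMap.congr_fun (M.linearMap_ext (f := f ∘ₗ M.act a) (g := N.act a ∘ₗ f)
      fun i m hm => ?_)
    have h1 := N.leibniz a (hh.1 i m hm)
    have h2 := M.leibniz a hm
    simp only [LinearMap.comp_apply, ← e, map_add, hh.2, h1, h2]
    rw [show i + -1 = i - 1 by ring, Int.negOnePow_sub, Int.negOnePow_one]
    simp only [Units.smul_def, map_zsmul, hh.2]
    simp
    abel
  · rw [← e, ← e, M.d_d, map_zero, add_zero, map_add, N.d_d, zero_add]

/-! ### ### Induction along a semi-free basis -/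

/-- The data of a semi-free basis. -/
structure SemifreeBasis (S : DGMod A) (n : ℕ) where
  e : Fin n → S.carrier
  deg : Fin n → ℤ
  mem : ∀ j, e j ∈ S.gr (deg j)
  equiv : (Fin n → A.carrier) ≃ₗ[ℂ] S.carrier
  equiv_apply : ∀ a, equiv a = ∑ j, S.act (a j) (e j)
  d_mem : ∀ j, S.d (e j) ∈ Submodule.span ℂ {x | ∃ i < j, ∃ a, x = S.act a (e i)}

theorem IsSemifree.exists_basis {S : DGMod A} (h : S.IsSemifree) :
    ∃ n, Nonempty (SemifreeBasis S n) := by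
  obtain ⟨n, e, deg, hm, hb, hd⟩ := h
  let f : (Fin n → A.carrier) →ₗ[ℂ] S.carrier :=
    ∑ j, S.act.flip (e j) ∘ₗ LinearMap.proj j
  have hf : ∀ a, f a = ∑ j, S.act (a j) (e j) := fun a => by simp [f]
  have hf' : Function.Bijective f := by
    rwa [show (f : (Fin n → A.carrier) → S.carrier) = _ from funext hf]
  exact ⟨n, ⟨⟨e, deg, hm, LinearEquiv.ofBijective f hf', hf, hd⟩⟩⟩

namespace SemifreeBasis

variable {S M : DGMod A} {n : ℕ} (b : SemifreeBasis S n)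

/-- The coordinates with respect to a semi-free basis. -/
def coord (j : Fin n) : S.carrier →ₗ[ℂ] A.carrier := LinearMap.proj j ∘ₗ b.equiv.symm.toLinearMap

theorem coord_equiv (a : Fin n → A.carrier) (j : Fin n) : b.coord j (b.equiv a) = a j := by
  simp [coord]

theorem sum_coord (m : S.carrier) : ∑ j, S.act (b.coord j m) (b.e j) = m := by
  rw [← b.equiv.apply_symm_apply m, equiv_apply]
  simp [coord, ← equiv_apply]

theorem coord_act (a : A.carrier) (m : S.carrier) (j : Fin n) :
    b.coord j (S.act a m) = b.coord j m * a := by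
  obtain ⟨c, rfl⟩ := b.equiv.surjective m
  have : S.act a (b.equiv c) = b.equiv fun i => c i * a := by
    simp [equiv_apply, S.act_mul]
  rw [this, coord_equiv, coord_equiv]

theorem coord_e (i j : Fin n) : b.coord i (b.e j) = if i = j then 1 else 0 := by
  have : b.e j = b.equiv (Pi.single j 1) := by
    rw [equiv_apply, Finset.sum_eq_single j]
    · simp [S.act_one]
    · intro i _ hi
      simp [hi]
    · simp
  rw [this, coord_equiv, Pi.single_apply]

theorem coord_act_e (a : A.carrier) (i j : Fin n) :
    b.coord i (S.act a (b.e j)) = if i = j then a else 0 := by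
  rw [coord_act, coord_e]
  split_ifs <;> simp

theorem ext_of_linear {f g : S.carrier →ₗ[ℂ] M.carrier}
    (hf : ∀ a m, f (S.act a m) = M.act a (f m)) (hg : ∀ a m, g (S.act a m) = M.act a (g m))
    (h : ∀ j, f (b.e j) = g (b.e j)) : f = g := by
  refine LinearMap.ext fun m => ?_
  rw [← b.sum_coord m, map_sum, map_sum]
  exact Finset.sum_congr rfl fun j _ => by rw [hf, hg, h]

theorem gr_le (i : ℤ) :
    S.gr i ≤ ⨆ j, (A.gr (i - b.deg j)).map (S.act.flip (b.e j)) := by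
  refine S.gr_eq_of_le (V := fun i => ⨆ j, (A.gr (i - b.deg j)).map (S.act.flip (b.e j)))
    (fun i => iSup_le fun j => ?_) ?_ i
  · rintro _ ⟨a, ha, rfl⟩
    have := S.act_mem (b.mem j) ha
    rwa [add_sub_cancel] at this
  · rw [eq_top_iff]
    intro m _
    rw [← b.sum_coord m]
    refine sum_mem fun j _ => ?_
    have : (⨆ p, A.gr p).map (S.act.flip (b.e j)) ≤
        ⨆ i, ⨆ j, (A.gr (i - b.deg j)).map (S.act.flip (b.e j)) := by
      rw [Submodule.map_iSup]
      refine iSup_le fun p => le_iSup_of_le (p + b.deg j) (le_iSup_of_le j ?_)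
      rw [add_sub_cancel_right]
    have hA : b.coord j m ∈ ⨆ p, A.gr p := by
      rw [show ⨆ p, A.gr p = ⊤ from iSup_gr (self A)]
      trivial
    exact this ⟨_, hA, rfl⟩

/-- The `A`-linear map with prescribed values on the basis. -/
def lift (y : Fin n → M.carrier) : S.carrier →ₗ[ℂ] M.carrier :=
  ∑ j, M.act.flip (y j) ∘ₗ b.coord j

theorem lift_apply (y : Fin n → M.carrier) (m : S.carrier) :
    b.lift y m = ∑ j, M.act (b.coord j m) (y j) := by
  simp [lift]

theorem lift_act (y : Fin n → M.carrier) (a : A.carrier) (m : S.carrier) :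
    b.lift y (S.act a m) = M.act a (b.lift y m) := by
  simp [lift_apply, coord_act, M.act_mul]

theorem lift_e (y : Fin n → M.carrier) (j : Fin n) : b.lift y (b.e j) = y j := by
  rw [lift_apply, Finset.sum_eq_single j]
  · simp [coord_e, M.act_one]
  · intro i _ hi
    simp [coord_e, hi]
  · simp

theorem lift_mem_homDeg {k : ℤ} {y : Fin n → M.carrier} (hy : ∀ j, y j ∈ M.gr (b.deg j + k)) :
    b.lift y ∈ homDeg S M k := by
  refine ⟨fun i m hm => ?_, b.lift_act y⟩
  have : (⨆ j, (A.gr (i - b.deg j)).map (S.act.flip (b.e j))) ≤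
      (M.gr (i + k)).comap (b.lift y) := by
    refine iSup_le fun j => ?_
    rintro _ ⟨a, ha, rfl⟩
    have := M.act_mem (hy j) ha
    rw [Submodule.mem_comap, LinearMap.flip_apply, lift_act, lift_e]
    rwa [show b.deg j + k + (i - b.deg j) = i + k by ring] at this
  exact this (b.gr_le i hm)

/-- The morphisms vanishing on the first `k` basis elements. -/
def homsVanishing (b : SemifreeBasis S n) (M : DGMod A) (k : ℕ) :
    Submodule ℂ (S.carrier →ₗ[ℂ] M.carrier) where
  carrier := {f | f ∈ homs S M ∧ ∀ j, j.val < k → f (b.e j) = 0}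
  add_mem' hf hg := ⟨add_mem hf.1 hg.1, fun j hj => by simp [hf.2 j hj, hg.2 j hj]⟩
  zero_mem' := ⟨zero_mem _, fun _ _ => rfl⟩
  smul_mem' c f hf := ⟨Submodule.smul_mem _ c hf.1, fun j hj => by simp [hf.2 j hj]⟩

/-- The differential is triangular in the basis. Thus a morphism vanishing on the earlier basis
elements sends the next one to a cocycle, its obstruction class. -/
theorem map_d_e_eq_zero {f : S.carrier →ₗ[ℂ] M.carrier}
    (hf : ∀ a m, f (S.act a m) = M.act a (f m)) {j : Fin n} (h : ∀ i < j, f (b.e i) = 0) :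
    f (S.d (b.e j)) = 0 := by
  have : Submodule.span ℂ {x | ∃ i < j, ∃ a, x = S.act a (b.e i)} ≤ LinearMap.ker f := by
    rw [Submodule.span_le]
    rintro _ ⟨i, hi, a, rfl⟩
    change f _ = 0
    rw [hf, h i hi, map_zero]
  exact this (b.d_mem j)

/-- A morphism vanishing on the first basis elements whose value at the next one is a boundary can
be made to vanish there, too, by a homotopy. -/
theorem mem_homsVanishing_succ_sup {f : S.carrier →ₗ[ℂ] M.carrier} {j : Fin n}
    (hf : f ∈ b.homsVanishing M j) (h : f (b.e j) ∈ LinearMap.range M.d) :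
    f ∈ b.homsVanishing M (j + 1) ⊔ nullHomotopic S M := by
  have hfe : f (b.e j) ∈ M.gr (b.deg j) := by simpa using hf.1.1.1 _ _ (b.mem j)
  obtain ⟨y, hy, hdy⟩ := M.exists_homogeneous_primitive hfe h
  -- The homotopy sends `e j` to a primitive of `f (e j)` and the other basis elements to 0, so the
  -- values at earlier ones are unaffected.
  have hs : b.lift (M := M) (Pi.single j y) ∈ homDeg S M (-1) := by
    refine b.lift_mem_homDeg fun i => ?_
    by_cases hi : i = j
    · subst hi
      simpa [sub_eq_add_neg] using hy
    · simp [hi]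
  have hN : M.d ∘ₗ b.lift (Pi.single j y) + b.lift (Pi.single j y) ∘ₗ S.d ∈ nullHomotopic S M :=
    mem_nullHomotopic.2 ⟨_, hs, fun m => rfl⟩
  have key : ∀ i ≤ j, b.lift (M := M) (Pi.single j y) (S.d (b.e i)) = 0 := fun i hi =>
    b.map_d_e_eq_zero (b.lift_act _) fun l hl => by
      rw [lift_e, Pi.single_eq_of_ne (hl.trans_le hi).ne]
  refine Submodule.mem_sup.2 ⟨_, ⟨sub_mem hf.1 (nullHomotopic_le_homs _ _ hN), fun i hi => ?_⟩,
    _, hN, sub_add_cancel _ _⟩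
  simp only [LinearMap.sub_apply, LinearMap.add_apply, LinearMap.comp_apply, lift_e]
  rw [key i (Fin.le_def.2 (by omega))]
  by_cases hij : i = j
  · subst hij
    simp [hdy]
  · have : i.val < j := lt_of_le_of_ne (by omega) fun h => hij (Fin.ext h)
    simp [hij, hf.2 i this]

theorem homsVanishing_zero (M : DGMod A) : b.homsVanishing M 0 = homs S M :=
  le_antisymm (fun _ hf => hf.1) fun _ hf => ⟨hf, fun _ h => absurd h (Nat.not_lt_zero _)⟩

theorem homsVanishing_card (M : DGMod A) : b.homsVanishing M n = ⊥ := by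
  rw [eq_bot_iff]
  intro f hf
  exact b.ext_of_linear (M := M) hf.1.1.2 (by simp) fun j => hf.2 j j.2

/-- On an acyclic target no obstruction class survives; the induction runs downwards from maps that
vanish on the whole basis. -/
theorem homs_le_nullHomotopic (b : SemifreeBasis S n)
    (h : ∀ i, ∀ m ∈ M.gr i, M.d m = 0 → m ∈ LinearMap.range M.d) :
    homs S M ≤ nullHomotopic S M := by
  suffices ∀ k ≤ n, b.homsVanishing M k ≤ nullHomotopic S M by
    simpa [homsVanishing_zero] using this 0 (Nat.zero_le n)
  intro k hk
  refine Nat.decreasingInduction (motive := fun k _ => b.homsVanishing M k ≤ nullHomotopic S M)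
    (fun k hk ih f hf => ?_) ?_ hk
  · refine (sup_le ih le_rfl) (b.mem_homsVanishing_succ_sup (j := ⟨k, hk⟩) hf ?_)
    refine h _ _ (hf.1.1.1 _ _ (b.mem _)) ?_
    rw [← hf.1.2]
    exact b.map_d_e_eq_zero hf.1.1.2 fun i hi => hf.2 i hi
  · rw [homsVanishing_card]
    exact bot_le

/-- At each basis element the obstruction lies in the image of `U`, so killing it costs a
finite-dimensional space of morphisms. -/
theorem exists_homs_le_sup (b : SemifreeBasis S n) {U : Submodule ℂ M.carrier} [FiniteDimensional ℂ U]
    (hU : LinearMap.ker M.d ≤ U ⊔ LinearMap.range M.d) :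
    ∃ W ≤ homs S M, FiniteDimensional ℂ W ∧ homs S M ≤ W ⊔ nullHomotopic S M := by
  suffices ∀ k ≤ n, ∃ W ≤ homs S M, FiniteDimensional ℂ W ∧
      b.homsVanishing M k ≤ W ⊔ nullHomotopic S M by
    simpa [homsVanishing_zero] using this 0 (Nat.zero_le n)
  intro k hk
  refine Nat.decreasingInduction (motive := fun k _ => ∃ W ≤ homs S M, FiniteDimensional ℂ W ∧
      b.homsVanishing M k ≤ W ⊔ nullHomotopic S M) (fun k hk ih => ?_) ?_ hk
  · obtain ⟨W, hW, _, h⟩ := ih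
    let ev : (S.carrier →ₗ[ℂ] M.carrier) →ₗ[ℂ] M.carrier ⧸ LinearMap.range M.d :=
      (LinearMap.range M.d).mkQ ∘ₗ LinearMap.applyₗ (b.e ⟨k, hk⟩)
    have hev : (b.homsVanishing M k).map ev ≤ U.map (LinearMap.range M.d).mkQ := by
      rintro _ ⟨f, hf, rfl⟩
      have : f (b.e ⟨k, hk⟩) ∈ LinearMap.ker M.d := by
        change M.d _ = 0
        rw [← hf.1.2]
        exact b.map_d_e_eq_zero hf.1.1.2 fun i hi => hf.2 i hi
      obtain ⟨u, hu, y, hy, e⟩ := Submodule.mem_sup.1 (hU this)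
      refine ⟨u, hu, ?_⟩
      change _ = (LinearMap.range M.d).mkQ (f (b.e ⟨k, hk⟩))
      rw [← e, map_add, Submodule.mkQ_apply _ y, (Submodule.Quotient.mk_eq_zero _).2 hy, add_zero]
    obtain ⟨D, hD, _, hle⟩ := exists_le_sup_ker ev _ hev
    refine ⟨D ⊔ W, sup_le (hD.trans fun _ hf => hf.1) hW, inferInstance, hle.trans ?_⟩
    refine sup_le (le_sup_left.trans le_sup_left) fun f hf => ?_
    have hf2 : f (b.e ⟨k, hk⟩) ∈ LinearMap.range M.d := (Submodule.Quotient.mk_eq_zero _).1 hf.2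
    exact (sup_le (h.trans (sup_le_sup_right le_sup_right _)) le_sup_right)
      (b.mem_homsVanishing_succ_sup (j := ⟨k, hk⟩) hf.1 hf2)
  · exact ⟨⊥, bot_le, inferInstance, by rw [homsVanishing_card]; exact bot_le⟩

/-- The elements whose coordinates vanish from the `k`-th on. -/
def filtration (k : ℕ) : Submodule ℂ S.carrier where
  carrier := {m | ∀ j : Fin n, k ≤ j.val → b.coord j m = 0}
  add_mem' hx hy j hj := by simp [hx j hj, hy j hj]
  zero_mem' j _ := map_zero _
  smul_mem' c x hx j hj := by simp [hx j hj]

theorem act_mem_filtration {k : ℕ} (a : A.carrier) {m : S.carrier} (hm : m ∈ b.filtration k) :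
    S.act a m ∈ b.filtration k := fun j hj => by rw [coord_act, hm j hj, zero_mul]

theorem e_mem_filtration {k : ℕ} {j : Fin n} (hj : j.val < k) : b.e j ∈ b.filtration k :=
  fun i hi => by rw [coord_e, if_neg]; rintro rfl; omega

theorem d_e_mem_filtration (j : Fin n) : S.d (b.e j) ∈ b.filtration j := by
  have : Submodule.span ℂ {x | ∃ i < j, ∃ a, x = S.act a (b.e i)} ≤ b.filtration j := by
    rw [Submodule.span_le]
    rintro _ ⟨i, hi, a, rfl⟩
    exact b.act_mem_filtration a (b.e_mem_filtration hi)
  exact this (b.d_mem j)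

theorem filtration_mono {k l : ℕ} (h : k ≤ l) : b.filtration k ≤ b.filtration l :=
  fun _ hm j hj => hm j (h.trans hj)

theorem d_mem_filtration {k : ℕ} {m : S.carrier} (hm : m ∈ b.filtration k) :
    S.d m ∈ b.filtration k := by
  rw [← b.sum_coord m, map_sum]
  refine sum_mem fun j _ => ?_
  by_cases hj : k ≤ j.val
  · simp [hm j hj]
  · rw [S.leibniz _ (b.mem j), Units.smul_def]
    exact add_mem (b.act_mem_filtration _ (b.filtration_mono (by omega) (b.d_e_mem_filtration j)))
      (zsmul_mem (b.act_mem_filtration _ (b.e_mem_filtration (by omega))) _)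

theorem sub_mem_filtration {j : Fin n} {m : S.carrier} (hm : m ∈ b.filtration (j + 1)) :
    m - S.act (b.coord j m) (b.e j) ∈ b.filtration j := by
  intro i hi
  rw [map_sub, coord_act_e]
  split_ifs with h
  · subst h
    exact sub_self _
  · rw [sub_zero]
    exact hm i (lt_of_le_of_ne hi fun h' => h (Fin.ext h'.symm))

/-- On the successive quotients of the filtration the differential is that of `A`, up to the sign of
the shift. -/
theorem coord_d {j : Fin n} {m : S.carrier} (hm : m ∈ b.filtration (j + 1)) :
    b.coord j (S.d m) = (b.deg j).negOnePow • A.d (b.coord j m) := by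
  have h1 := b.d_mem_filtration (b.sub_mem_filtration hm) j le_rfl
  rw [map_sub, map_sub, sub_eq_zero, S.leibniz _ (b.mem j), map_add, coord_act,
    b.d_e_mem_filtration j j le_rfl, zero_mul, zero_add] at h1
  rw [h1, Units.smul_def, Units.smul_def, map_zsmul, coord_act_e, if_pos rfl]

/-- Finite-dimensionality of cohomology passes up the filtration: the leading coordinate of a
cocycle is a cocycle of `A`, and when it is a boundary the cocycle can be moved one step down. -/
theorem exists_ker_le (b : SemifreeBasis S n) {U : Submodule ℂ A.carrier} [FiniteDimensional ℂ U]
    (hU : LinearMap.ker A.d ≤ U ⊔ LinearMap.range A.d) :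
    ∃ W : Submodule ℂ S.carrier, FiniteDimensional ℂ W ∧
      LinearMap.ker S.d ≤ W ⊔ LinearMap.range S.d := by
  suffices ∀ k ≤ n, ∃ W : Submodule ℂ S.carrier, FiniteDimensional ℂ W ∧
      b.filtration k ⊓ LinearMap.ker S.d ≤ W ⊔ LinearMap.range S.d by
    obtain ⟨W, hW, h⟩ := this n le_rfl
    exact ⟨W, hW, fun m hm => h ⟨fun j hj => absurd j.2 (by omega), hm⟩⟩
  intro k
  induction k with
  | zero =>
    refine fun _ => ⟨⊥, inferInstance, ?_⟩
    rintro m ⟨hm, -⟩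
    rw [← b.sum_coord m]
    exact sum_mem fun j _ => by simp [hm j (Nat.zero_le _)]
  | succ k ih =>
    intro hk
    obtain ⟨W, _, h⟩ := ih (by omega)
    let j : Fin n := ⟨k, hk⟩
    let p : S.carrier →ₗ[ℂ] A.carrier ⧸ LinearMap.range A.d :=
      (LinearMap.range A.d).mkQ ∘ₗ b.coord j
    have hp : (b.filtration (k + 1) ⊓ LinearMap.ker S.d).map p ≤
        U.map (LinearMap.range A.d).mkQ := by
      rintro _ ⟨m, ⟨hm, hdm⟩, rfl⟩
      have h0 : b.coord j m ∈ LinearMap.ker A.d := by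
        have h1 := b.coord_d (j := j) hm
        have h2 : S.d m = 0 := hdm
        rw [h2, map_zero] at h1
        exact (smul_eq_zero_iff_eq _).1 h1.symm
      obtain ⟨u, hu, y, hy, e⟩ := Submodule.mem_sup.1 (hU h0)
      refine ⟨u, hu, ?_⟩
      change _ = (LinearMap.range A.d).mkQ (b.coord j m)
      rw [← e, map_add, Submodule.mkQ_apply _ y, (Submodule.Quotient.mk_eq_zero _).2 hy, add_zero]
    obtain ⟨D, hD, _, hle⟩ := exists_le_sup_ker p _ hp
    refine ⟨D ⊔ W, inferInstance, hle.trans ?_⟩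
    refine sup_le (le_sup_left.trans le_sup_left) ?_
    rintro m ⟨⟨hm, hdm⟩, hpm⟩
    obtain ⟨a, ha⟩ : b.coord j m ∈ LinearMap.range A.d := (Submodule.Quotient.mk_eq_zero _).1 hpm
    -- The sign cancels the one in `coord_d`, so that `d z` has the same `j`-th coordinate as `m`.
    let z := (b.deg j).negOnePow • S.act a (b.e j)
    have hz : z ∈ b.filtration (j + 1) := by
      rw [show z = _ from Units.smul_def _ _]
      exact zsmul_mem (b.act_mem_filtration _ (b.e_mem_filtration (Nat.lt_succ_self _))) _
    have hcz : b.coord j (S.d z) = b.coord j m := by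
      rw [b.coord_d hz, ← ha]
      simp only [z, Units.smul_def, map_zsmul, coord_act_e, if_pos]
      rw [smul_smul, ← Units.val_mul, Int.units_mul_self, Units.val_one, one_smul]
    have hmz : m - S.d z ∈ b.filtration k ⊓ LinearMap.ker S.d := by
      refine ⟨?_, ?_⟩
      · have := b.sub_mem_filtration (j := j) (sub_mem hm (b.d_mem_filtration hz))
        rwa [map_sub, hcz, sub_self, map_zero, LinearMap.zero_apply, sub_zero] at this
      · change S.d _ = 0
        rw [map_sub, S.d_d, show S.d m = 0 from hdm, sub_zero]
    rw [← sub_add_cancel m (S.d z)]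
    exact add_mem ((h.trans (sup_le_sup_right le_sup_right _)) hmz)
      (le_sup_right (a := D ⊔ W) ⟨z, rfl⟩)

end SemifreeBasis
theorem isSemifree_self (A : DGAlgebra.{u}) : (self A).IsSemifree := by
  have h1 : ∀ (a m : A.carrier), (self A).act a m = m * a := fun a m => rfl
  refine ⟨1, fun _ => (1 : A.carrier), fun _ => 0, fun _ => A.one_mem, ⟨fun a a' h => ?_,
    fun a => ⟨fun _ => a, ?_⟩⟩, fun _ => ?_⟩
  · funext j
    have h2 : ∑ j, (self A).act (a j) (1 : A.carrier) = ∑ j, (self A).act (a' j) (1 : A.carrier) := h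
    rw [Fin.sum_univ_one, Fin.sum_univ_one, h1, h1, one_mul, one_mul] at h2
    rw [Subsingleton.elim j 0, h2]
  · change ∑ j : Fin 1, (self A).act a (1 : A.carrier) = a
    rw [Fin.sum_univ_one]
    exact one_mul (M := A.carrier) a
  · rw [show (self A).d (1 : A.carrier) = 0 from A.d_one]
    exact zero_mem _

/-- The morphism `a ↦ m a` from a shift of `A` defined by a homogeneous cocycle `m`. -/
def ofCocycle (M : DGMod A) {i : ℤ} {m : M.carrier} (hm : m ∈ M.gr i) (hd : M.d m = 0) :
    (self A).shift (-i) ⟶ M :=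
  ofLin (M := (self A).shift (-i)) (M.act.flip m)
    ⟨⟨fun p a ha => by
        have := M.act_mem hm (show a ∈ A.gr (p + -i) from ha)
        change M.act a m ∈ M.gr (p + 0)
        rwa [show i + (p + -i) = p + 0 by ring] at this,
      fun a c => M.act_mul c a m⟩, fun (a : A.carrier) => by
        change M.act ((-i).negOnePow • A.d a) m = M.d (M.act a m)
        rw [M.leibniz a hm, hd, map_zero, zero_add, Int.negOnePow_neg, Units.smul_def,
          Units.smul_def, map_zsmul, LinearMap.smul_apply]⟩

/-- Evaluating the homotopy at `1`, which is a cocycle, gives a primitive of `m`. -/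
theorem mem_range_d_of_homotopic_zero (M : DGMod A) {i : ℤ} {m : M.carrier} (hm : m ∈ M.gr i)
    (hd : M.d m = 0) (h : homotopic A (M.ofCocycle hm hd) 0) : m ∈ LinearMap.range M.d := by
  obtain ⟨s, -, e⟩ := h
  have h1 := e (1 : A.carrier)
  have h2 : ((self A).shift (-i)).d (1 : A.carrier) = 0 := by
    change (-i).negOnePow • A.d 1 = 0
    rw [A.d_one, smul_zero]
  rw [h2, map_zero, add_zero] at h1
  refine ⟨s (1 : A.carrier), h1.symm.trans ?_⟩
  change M.act 1 m - 0 = m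
  rw [M.act_one, sub_zero]

theorem homotopic_zero_iff {M N : DGMod A} (f : M ⟶ N) :
    homotopic A f 0 ↔ lin f ∈ nullHomotopic M N := by
  rw [mem_nullHomotopic]
  refine exists_congr fun h => and_congr_right fun _ => forall_congr' fun m => ?_
  rw [show lin (0 : M ⟶ N) = 0 from rfl, LinearMap.zero_apply, sub_zero, eq_comm]

end DGMod

/-! ### ### Hom-finiteness and generation in the homotopy category -/

namespace HoDGMod

variable {A : DGAlgebra.{u}}

theorem map_eq_zero_iff {M N : DGMod A} (f : M ⟶ N) :
    (Quotient.functor (DGMod.homotopic A)).map f = 0 ↔ DGMod.lin f ∈ DGMod.nullHomotopic M N := by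
  rw [← DGMod.homotopic_zero_iff, ← Functor.map_zero]
  exact Quotient.functor_map_eq_iff _ _ _

theorem finiteDimensional_hom (hA : A.IsProper) {S S' : DGMod A} (hS : S.IsSemifree)
    (hS' : S'.IsSemifree) :
    FiniteDimensional ℂ ((Quotient.functor (DGMod.homotopic A)).obj S ⟶
      (Quotient.functor (DGMod.homotopic A)).obj S') := by
  obtain ⟨n, ⟨b⟩⟩ := hS.exists_basis
  obtain ⟨n', ⟨b'⟩⟩ := hS'.exists_basis
  obtain ⟨U, _, hU⟩ := hA.exists_ker_le
  obtain ⟨U', _, hU'⟩ := b'.exists_ker_le hU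
  obtain ⟨W, hW, _, hle⟩ := b.exists_homs_le_sup hU'
  let F := (Quotient.functor (DGMod.homotopic A)).mapLinearMap ℂ (X := S) (Y := S')
  let i : W →ₗ[ℂ] (S ⟶ S') := Submodule.inclusion hW
  refine Module.Finite.of_surjective (F ∘ₗ i) fun g => ?_
  obtain ⟨f, rfl⟩ := (Quotient.functor (DGMod.homotopic A)).map_surjective g
  obtain ⟨w, hw, s, hs, e⟩ := Submodule.mem_sup.1 (hle (DGMod.lin_mem f))
  refine ⟨⟨w, hw⟩, ?_⟩
  change (Quotient.functor (DGMod.homotopic A)).map (DGMod.ofLin w (hW hw)) = _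
  rw [← sub_eq_zero, ← Functor.map_sub, map_eq_zero_iff, DGMod.lin_sub, DGMod.lin_ofLin, ← e,
    sub_add_cancel_left]
  exact neg_mem hs

/-- If shifts of `A` do not see `M`, then every homogeneous cocycle of `M` is a boundary. So the
retraction from a semi-free module onto `M` is null-homotopic. -/
theorem IsPerfect.id_eq_zero {M : DGMod A}
    (hM : IsPerfect ((Quotient.functor (DGMod.homotopic A)).obj M))
    (h : ∀ (k : ℤ) (f : (DGMod.self A).shift k ⟶ M),
      (Quotient.functor (DGMod.homotopic A)).map f = 0) :
    𝟙 ((Quotient.functor (DGMod.homotopic A)).obj M) = 0 := by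
  obtain ⟨S, hS, ⟨r⟩⟩ := hM
  obtain ⟨n, ⟨b⟩⟩ := hS.exists_basis
  obtain ⟨f, hf⟩ := (Quotient.functor (DGMod.homotopic A)).map_surjective r.r
  have : r.r = 0 := by
    rw [← hf, map_eq_zero_iff]
    refine b.homs_le_nullHomotopic (fun i m hm hd => ?_) (DGMod.lin_mem f)
    refine M.mem_range_d_of_homotopic_zero hm hd ?_
    rw [DGMod.homotopic_zero_iff, ← map_eq_zero_iff]
    exact h _ _
  rw [← r.retract, this, comp_zero]

end HoDGMod

/-! ### ### Transfer along the equivalence with perf(A) -/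

section Triangulated

variable {T : Type*} [Category T] [Preadditive T] [HasZeroObject T] [HasShift T ℤ]
  [∀ n : ℤ, (shiftFunctor T n).Additive] [Pretriangulated T] [Linear ℂ T] {A : DGAlgebra.{u}}

/-- Composing with the retractions embeds the Hom space into one between semi-free modules. -/
theorem IsEquivalentToPerf.finiteDimensional_hom (hT : IsEquivalentToPerf T A) (hA : A.IsProper)
    (X Y : T) : FiniteDimensional ℂ (X ⟶ Y) := by
  obtain ⟨F, _, _, _, _, _, -, hF⟩ := hT
  obtain ⟨S, hS, ⟨r⟩⟩ := (hF _).1 (F.obj_mem_essImage X)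
  obtain ⟨S', hS', ⟨r'⟩⟩ := (hF _).1 (F.obj_mem_essImage Y)
  have := HoDGMod.finiteDimensional_hom hA hS hS'
  refine Module.Finite.of_injective
    (Linear.rightComp ℂ _ r'.i ∘ₗ Linear.leftComp ℂ _ r.r ∘ₗ F.mapLinearMap ℂ) fun f g h => ?_
  have h' : (r.r ≫ F.map f) ≫ r'.i = (r.r ≫ F.map g) ≫ r'.i := h
  have h1 := congrArg (fun x => r.i ≫ x ≫ r'.r) h'
  simp only [Category.assoc, r'.retract, Category.comp_id] at h1
  rw [r.retract_assoc, r.retract_assoc] at h1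
  exact F.map_injective h1

theorem IsEquivalentToPerf.exists_generator (hT : IsEquivalentToPerf T A) :
    ∃ G : T, ∀ X : T, (∀ (k : ℤ) (f : G⟦k⟧ ⟶ X), f = 0) → IsZero X := by
  obtain ⟨F, _, _, _, _, _, -, hF⟩ := hT
  let Q := Quotient.functor (DGMod.homotopic A)
  obtain ⟨G, ⟨e⟩⟩ := (hF (Q.obj (DGMod.self A))).2 ⟨_, DGMod.isSemifree_self A, ⟨Retract.refl _⟩⟩
  refine ⟨G, fun X hX => ?_⟩
  rw [IsZero.iff_id_eq_zero]
  apply F.map_injective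
  rw [F.map_id, F.map_zero]
  refine HoDGMod.IsPerfect.id_eq_zero (M := (F.obj X).as) ((hF _).1 (F.obj_mem_essImage X))
    fun k f => ?_
  let e' : F.obj (G⟦k⟧) ≅ Q.obj ((DGMod.self A).shift k) :=
    (F.commShiftIso k).app G ≪≫ (shiftFunctor _ k).mapIso e ≪≫
      (Q.commShiftIso k).symm.app (DGMod.self A)
  obtain ⟨g, hg⟩ := F.map_surjective (X := G⟦k⟧) (Y := X) (e'.hom ≫ Q.map f)
  rw [hX k g, F.map_zero] at hg
  exact (cancel_epi e'.hom).1 (hg.symm.trans comp_zero.symm)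

end Triangulated

end DGStab

end

theorem proposition5p8 {T : Type*} [Category T] [Preadditive T] [HasZeroObject T] [HasShift T ℤ]
    [∀ n : ℤ, (shiftFunctor T n).Additive] [Pretriangulated T] [IsTriangulated T] [Linear ℂ T]
    (A : DGStab.DGAlgebra) (hsmooth : A.IsSmooth) (hproper : A.IsProper)
    (hT : DGStab.IsEquivalentToPerf T A)
    {Λ : Type*} [AddCommGroup Λ] [Module.Free ℤ Λ] [Module.Finite ℤ Λ]
    (v : DGStab.K₀ T →+ Λ) (hv : Function.Surjective v)
    (nrm : Seminorm ℝ (TensorProduct ℤ ℝ Λ)) (hnrm : ∀ x, nrm x = 0 → x = 0)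
    (σ : DGStab.StabilityCondition T v nrm) (hσ : σ.gldim < 1)
    (hconn : DGStab.IsConnected T) :
    ∃ (n : ℕ) (E : Fin n → T), DGStab.IsExceptionalCollection E ∧ DGStab.IsStrong E ∧
      DGStab.IsFull E := by
  obtain ⟨d, hd⟩ := DGStab.StabilityCondition.exists_thin hnrm hσ
  obtain ⟨G, hG⟩ := hT.exists_generator
  exact hd.exists_full_strong_exceptional_collection (hT.finiteDimensional_hom hproper) hG
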